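/- Let $p>1$ and let $(X,\|\cdot\|)$ be a real Banach space whose norm is locally uniformly convex and uniformly smooth. For $f:X\to\mathbb R\cup\{+\infty\}$ and $n\in\mathbb N$, $n\ge 1$, put $$g_n^p(x):=\inf_{y\in X}\Big\{f(y)+2^{p-1}n\|x\|^p+2^{p-1}n\|y\|^p-n\|x+y\|^p\Big\}+2^{p-1}n\|x\|^p,\qquad \Delta_n^pf:=\operatorname{co}g_n^p-2^{p-1}n\|\cdot\|^p,$$ where $\operatorname{co}g$ denotes the greatest proper convex lower semicontinuous function below $g$. Write $\operatorname{arginf}h=\{x: h(x)=\inf h\}$. A real function is $\Delta$-convex if it is the difference of two continuous convex functions. $C_B^{1,u}(X)$ is the set of Fréchet differentiable functions $X\to\mathbb R$ whose derivative is uniformly continuous on bounded sets; $C^{1,\alpha}(X)$ (resp. $C_B^{1,\alpha}(X)$) is the set of Fréchet differentiable functions whose derivative is $\alpha$-Hölder on $X$ (resp. on every bounded set, with a constant that may depend on the set). The modulus of smoothness $\rho(\tau)=\sup\{\frac12(\|x+\tau y\|+\|x-\tau y\|)-1:\|x\|=\|y\|=1\}$ is of power type $q$ if $\rho(\tau)\le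 C\tau^q$ for all $\tau>0$ and some $C>0$; the modulus of convexity $\delta(\varepsilon)=\inf\{1-\|\frac{x+y}2\|:\|x\|=\|y\|=1,\ \|x-y\|\ge\varepsilon\}$ is of power type $q$ if $\delta(\varepsilon)\ge C\varepsilon^q$ for all $0<\varepsilon\le2$ and some $C>0$. Let $f:X\to\mathbb R\cup\{+\infty\}$ be proper (that is, $f\not\equiv+\infty$), lower semicontinuous and bounded below. Then every $\Delta_n^pf$ ($n\ge1$) is a real-valued $\Delta$-convex function, and: (i) for all $n\ge1$, $\inf f\le\Delta_n^pf\le f$ (so $\inf\Delta_n^pf=\inf f$) and $\operatorname{arginf}\Delta_n^pf=\operatorname{arginf}f$; (ii) $\Delta_n^pf\in C_B^{1,u}(X)$ for all $n\ge1$. If $0<\alpha\le1$ and the modulus of smoothness of the norm is of power type $1+\alpha$, then $\Delta_n^pf\in C_B^{1,\beta}(X)$ for all $n\ge 1$, with $\beta=\min\{\alpha,p-1\}$ (so $\beta=\alpha$ when $p\ge1+\alpha$); and if moreover $p=1+\alpha$, then $\Delta_n^pf\in C^{1,\alpha}(X)$ for all $n\ge1$; (iii) $\Delta_n^pf\to f$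 pointwise on $X$ as $n\to\infty$, and uniformly on every compact set if $f$ is real-valued and continuous. If moreover the norm is uniformly convex, then: (iv) $\Delta_n^pf\to f$ uniformly on every bounded set if $f$ (as above) is real-valued and uniformly continuous on bounded sets; (v) if $p\ge2$ and the modulus of convexity of the norm is of power type $p$, then for every uniformly continuous $f:X\to\mathbb R$ (not necessarily bounded below) all $\Delta_n^pf$ ($n\ge1$) are real-valued and $\Delta$-convex, and $\Delta_n^pf\to f$ uniformly on $X$. -/

import Mathlib

open Filter Topology

noncomputable section

namespace DeltaApprox

/-! ### Geometry of the norm -/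

section Norm

variable (X : Type*) [NormedAddCommGroup X] [NormedSpace ℝ X]

/-- The norm of `X` is locally uniformly convex (locally uniformly rotund). -/
def LocallyUniformlyConvex : Prop :=
  ∀ x : X, ‖x‖ = 1 → ∀ ε : ℝ, 0 < ε →
    ∃ δ : ℝ, 0 < δ ∧ ∀ y : X, ‖y‖ = 1 → ε ≤ ‖x - y‖ → ‖x + y‖ ≤ 2 - δ

/-- The modulus of smoothness
`ρ(τ) = sup {(‖x + τ y‖ + ‖x - τ y‖) / 2 - 1 : ‖x‖ = ‖y‖ = 1}`. -/
def smoothnessModulus (τ : ℝ) : ℝ :=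
  sSup {s : ℝ | ∃ x y : X, ‖x‖ = 1 ∧ ‖y‖ = 1 ∧ s = (‖x + τ • y‖ + ‖x - τ • y‖) / 2 - 1}

/-- The norm of `X` is uniformly smooth: `ρ(τ) / τ → 0` as `τ → 0+`. -/
def UniformlySmooth : Prop :=
  Tendsto (fun τ : ℝ => smoothnessModulus X τ / τ) (𝓝[>] 0) (𝓝 0)

/-- The modulus of smoothness is of power type `q`: `ρ(τ) ≤ C τ ^ q`. -/
def SmoothnessPowerType (q : ℝ) : Prop :=
  ∃ C : ℝ, 0 < C ∧ ∀ τ : ℝ, 0 < τ → smoothnessModulus X τ ≤ C * τ ^ q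

/-- The modulus of convexity
`δ(ε) = inf {1 - ‖(x + y) / 2‖ : ‖x‖ = ‖y‖ = 1, ‖x - y‖ ≥ ε}`
(extended-valued, so that the infimum of the empty set is `+∞`). -/
def convexityModulus (ε : ℝ) : EReal :=
  sInf {s : EReal | ∃ x y : X, ‖x‖ = 1 ∧ ‖y‖ = 1 ∧ ε ≤ ‖x - y‖ ∧
    s = ((1 - ‖(2⁻¹ : ℝ) • (x + y)‖ : ℝ) : EReal)}

/-- The modulus of convexity is of power type `q`: `δ(ε) ≥ C ε ^ q` for `0 < ε ≤ 2`. -/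
def ConvexityPowerType (q : ℝ) : Prop :=
  ∃ C : ℝ, 0 < C ∧ ∀ ε : ℝ, 0 < ε → ε ≤ 2 →
    ((C * ε ^ q : ℝ) : EReal) ≤ convexityModulus X ε

end Norm

variable {X : Type*} [NormedAddCommGroup X] [NormedSpace ℝ X]

/-! ### Extended-valued functions and the convex envelope -/

/-- The (possibly empty) set of minimizers of `f`. -/
def argInf (f : X → EReal) : Set X := {x | f x = ⨅ z, f z}

/-- `f` takes values in `ℝ ∪ {+∞}` and is not identically `+∞`. -/
def Proper (f : X → EReal) : Prop := (∀ x, f x ≠ ⊥) ∧ ∃ x, f x ≠ ⊤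

/-- `f` is bounded below by a real constant. -/
def BddBelowFun (f : X → EReal) : Prop := ∃ m : ℝ, ∀ x, (m : EReal) ≤ f x

/-- Convexity of an extended-valued function: its epigraph is convex. -/
def ConvexFun (f : X → EReal) : Prop :=
  Convex ℝ {q : X × ℝ | f q.1 ≤ (q.2 : EReal)}

/-- The proper convex l.s.c. functions below `g`. -/
def convexMinorants (g : X → EReal) : Set (X → EReal) :=
  {h | Proper h ∧ ConvexFun h ∧ LowerSemicontinuous h ∧ ∀ x, h x ≤ g x}

/-- The convex envelope `co g`: the greatest proper convex l.s.c. function below `g`, as the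
pointwise supremum of all of them (see `convexEnvelope_isGreatest`). -/
def convexEnvelope (g : X → EReal) (x : X) : EReal := ⨆ h ∈ convexMinorants g, h x

theorem convexEnvelope_isGreatest (g : X → EReal) (hg : ∃ x, g x ≠ ⊤)
    (hne : (convexMinorants g).Nonempty) :
    IsGreatest (convexMinorants g) (convexEnvelope g) := by
  have hle : ∀ x, convexEnvelope g x ≤ g x := fun x => iSup₂_le fun h hh => hh.2.2.2 x
  have hub : ∀ h ∈ convexMinorants g, ∀ x, h x ≤ convexEnvelope g x := fun h hh x =>
    le_iSup₂ (f := fun (h : X → EReal) (_ : h ∈ convexMinorants g) => h x) h hh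
  refine ⟨⟨⟨fun x hx => ?_, ?_⟩, ?_, ?_, hle⟩, fun h hh => hub h hh⟩
  · obtain ⟨h, hh⟩ := hne
    exact hh.1.1 x (le_bot_iff.mp (hx ▸ hub h hh x))
  · obtain ⟨x, hx⟩ := hg
    exact ⟨x, fun h => hx (top_le_iff.mp (h ▸ hle x))⟩
  · have : {q : X × ℝ | convexEnvelope g q.1 ≤ (q.2 : EReal)} =
        ⋂ h ∈ convexMinorants g, {q : X × ℝ | h q.1 ≤ (q.2 : EReal)} := by
      ext q
      simp [convexEnvelope]
    unfold ConvexFun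
    rw [this]
    exact convex_iInter₂ fun h hh => hh.2.1
  · exact lowerSemicontinuous_biSup fun h hh => hh.2.2.1

/-- `F` is a real-valued function that is the difference of two continuous convex functions. -/
def DeltaConvex (F : X → EReal) : Prop :=
  ∃ u v : X → ℝ, ConvexOn ℝ Set.univ u ∧ Continuous u ∧ ConvexOn ℝ Set.univ v ∧ Continuous v ∧
    ∀ x, F x = ((u x - v x : ℝ) : EReal)

/-! ### The approximating functions -/

/-- `g_n^p(x) = inf_y {f(y) + 2^(p-1) n ‖x‖^p + 2^(p-1) n ‖y‖^p - n ‖x + y‖^p}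
+ 2^(p-1) n ‖x‖^p`. -/
def gApprox (p : ℝ) (n : ℕ) (f : X → EReal) (x : X) : EReal :=
  (⨅ y : X, (f y + (((2 : ℝ) ^ (p - 1) * n * ‖x‖ ^ p + (2 : ℝ) ^ (p - 1) * n * ‖y‖ ^ p
      - n * ‖x + y‖ ^ p : ℝ) : EReal)))
    + (((2 : ℝ) ^ (p - 1) * n * ‖x‖ ^ p : ℝ) : EReal)

/-- `Δ_n^p f = co (g_n^p) - 2^(p-1) n ‖·‖^p`. -/
def deltaApprox (p : ℝ) (n : ℕ) (f : X → EReal) (x : X) : EReal :=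
  convexEnvelope (gApprox p n f) x - (((2 : ℝ) ^ (p - 1) * n * ‖x‖ ^ p : ℝ) : EReal)

/-! ### Smoothness classes and uniform continuity on bounded sets -/

/-- `F` is uniformly continuous on every bounded set. -/
def UniformContinuousOnBounded {Y : Type*} [UniformSpace Y] (F : X → Y) : Prop :=
  ∀ B : Set X, Bornology.IsBounded B → UniformContinuousOn F B

/-- The class `C_B^{1,u}(X)`: differentiable functions whose derivative is uniformly continuous on
bounded sets. -/
def IsC1uBdd (F : X → ℝ) : Prop :=
  Differentiable ℝ F ∧ UniformContinuousOnBounded (fderiv ℝ F)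

/-- The class `C^{1,α}(X)`: differentiable functions with `α`-Hölder derivative. -/
def IsC1Holder (α : ℝ) (F : X → ℝ) : Prop :=
  Differentiable ℝ F ∧ ∃ C : ℝ, ∀ x y : X, ‖fderiv ℝ F x - fderiv ℝ F y‖ ≤ C * ‖x - y‖ ^ α

/-- The class `C_B^{1,α}(X)`: differentiable functions whose derivative is `α`-Hölder on every
bounded set (with a constant depending on the set). -/
def IsC1HolderBdd (α : ℝ) (F : X → ℝ) : Prop :=
  Differentiable ℝ F ∧ ∀ B : Set X, Bornology.IsBounded B →
    ∃ C : ℝ, ∀ x ∈ B, ∀ y ∈ B, ‖fderiv ℝ F x - fderiv ℝ F y‖ ≤ C * ‖x - y‖ ^ α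

end DeltaApprox

end

set_option linter.unusedSectionVars false

namespace DeltaApprox

variable {X : Type*} [NormedAddCommGroup X] [NormedSpace ℝ X]

/-! ### The scalar cost -/

/-! Write φ = `powNorm p` and c = `cost p`. Convexity of the p-th power of the norm gives c ≥ 0, and
c(x, x) = 0. The function whose infimum over y defines `gApprox` is f(y) + n c(x, y) + n φ(x).

Two-sided estimate. Taking y = x gives Δ_n f ≤ f. For a lower bound, a subgradient ℓ of φ at x,
tested at the midpoint of x and z, yields the stronger inequality φ(z) ≥ φ(x) + ℓ(z - x) + c(x, z).
So a bound a ≤ f(y) + n (c(z, y) + c(x, z)) for all y, z produces an affine minorant with value a +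
n φ(x) at x, and hence a ≤ Δ_n f(x) (`IsEnvelope.le_deltaApprox`). Thus Δ_n f lies between f and a
two-step inf-convolution of f with the cost n c.

Convergence and minimizers. By rotundity, two steps of small cost stay close to their start:
uniformly on compact sets for a locally uniformly convex norm, on bounded sets for a uniformly
convex one (`CostControlled`). Points y far from x therefore pay a cost proportional to n, and
nearby ones are handled by semicontinuity or continuity of f. Under power type p the cost dominates
a multiple of ‖x - y‖ ^ p, which beats the linear growth of a uniformly continuous function.

Smoothness. Since -n ‖x + y‖ ^ p is concave in x, the minimized function has second differences in x
at most 2n times those of φ, uniformly in y. Averaging two translates of the envelope and rescaling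
gives a competitor for the envelope, so the bound passes to it (`IsEnvelope.secondDiff_le`). For a
convex function, small second differences give differentiability and a modulus of continuity of the
derivative. The second differences of φ are estimated through the modulus of smoothness. -/

/-- The scalar defect of midpoint convexity of `t ↦ t ^ p`. -/
noncomputable def scalarCost (p r s : ℝ) : ℝ := 2 ^ (p - 1) * (r ^ p + s ^ p) - (r + s) ^ p

theorem two_rpow_eq (p : ℝ) : (2 : ℝ) ^ p = 2 * 2 ^ (p - 1) := by
  rw [Real.rpow_sub_one two_ne_zero]; ring

theorem scalarCost_eq {p r s : ℝ} (hr : 0 ≤ r) (hs : 0 ≤ s) :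
    scalarCost p r s = 2 ^ p * ((1 / 2) * r ^ p + (1 / 2) * s ^ p
      - ((1 / 2 : ℝ) * r + (1 / 2) * s) ^ p) := by
  have h : r + s = 2 * ((1 / 2 : ℝ) * r + (1 / 2) * s) := by ring
  rw [scalarCost, h, Real.mul_rpow zero_le_two (by positivity), two_rpow_eq p]
  generalize (2 : ℝ) ^ (p - 1) = c
  ring

theorem scalarCost_nonneg {p r s : ℝ} (hp : 1 ≤ p) (hr : 0 ≤ r) (hs : 0 ≤ s) :
    0 ≤ scalarCost p r s := by
  rw [scalarCost_eq hr hs]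
  have := (convexOn_rpow hp).2 (Set.mem_Ici.2 hr) (Set.mem_Ici.2 hs) (by norm_num : (0 : ℝ) ≤ 1 / 2)
    (by norm_num : (0 : ℝ) ≤ 1 / 2) (by norm_num)
  simp only [smul_eq_mul] at this
  exact mul_nonneg (by positivity) (by linarith)

theorem scalarCost_pos {p r s : ℝ} (hp : 1 < p) (hr : 0 ≤ r) (hs : 0 ≤ s) (hrs : r ≠ s) :
    0 < scalarCost p r s := by
  rw [scalarCost_eq hr hs]
  have := (strictConvexOn_rpow hp).2 (Set.mem_Ici.2 hr) (Set.mem_Ici.2 hs) hrs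
    (by norm_num : (0 : ℝ) < 1 / 2)
    (by norm_num : (0 : ℝ) < 1 / 2) (by norm_num)
  simp only [smul_eq_mul] at this
  exact mul_pos (by positivity) (by linarith)

theorem scalarCost_comm (p r s : ℝ) : scalarCost p r s = scalarCost p s r := by
  rw [scalarCost, scalarCost, add_comm r s, add_comm (r ^ p)]

theorem scalarCost_mul {p t r s : ℝ} (ht : 0 ≤ t) (hr : 0 ≤ r) (hs : 0 ≤ s) :
    scalarCost p (t * r) (t * s) = t ^ p * scalarCost p r s := by
  rw [scalarCost, scalarCost, ← mul_add, Real.mul_rpow ht hr, Real.mul_rpow ht hs,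
    Real.mul_rpow ht (add_nonneg hr hs)]
  ring

/-- Strict convexity makes the cost positive for σ ≠ 1, and compactness of [0, 1 - η] makes this
uniform. -/
theorem exists_pos_le_scalarCost_one {p η : ℝ} (hp : 1 < p) (hη : 0 < η) :
    ∃ κ : ℝ, 0 < κ ∧ ∀ σ, 0 ≤ σ → σ ≤ 1 - η → κ ≤ scalarCost p 1 σ := by
  rcases lt_or_ge 1 η with h1 | h1
  · exact ⟨1, one_pos, fun σ h h' => by linarith⟩
  have hc : ContinuousOn (fun σ => scalarCost p 1 σ) (Set.Icc 0 (1 - η)) := by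
    have hp0 : 0 ≤ p := by linarith
    unfold scalarCost
    have := Real.continuous_rpow_const hp0
    exact (by fun_prop (disch := assumption) :
      Continuous fun σ : ℝ => 2 ^ (p - 1) * (1 ^ p + σ ^ p) - (1 + σ) ^ p).continuousOn
  obtain ⟨σ₀, hσ₀, hmin⟩ := isCompact_Icc.exists_isMinOn ⟨0, by simp [h1]⟩ hc
  exact ⟨_, scalarCost_pos hp zero_le_one hσ₀.1 (by linarith [hσ₀.2] : (1 : ℝ) ≠ σ₀),
    fun σ h h' => hmin ⟨h, h'⟩⟩

/-- Homogeneity reduces to the ratio of the two numbers. Only r is bounded: if s is much larger, the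
ratio is at most 1/2 and the bound still holds. -/
theorem exists_pos_le_scalarCost {p ε : ℝ} (hp : 1 < p) (R : ℝ) (hε : 0 < ε) :
    ∃ δ : ℝ, 0 < δ ∧ ∀ r s, 0 ≤ r → 0 ≤ s → r ≤ R → ε ≤ |r - s| → δ ≤ scalarCost p r s := by
  set R' := max R 1
  have hR' : 0 < R' := lt_of_lt_of_le one_pos (le_max_right _ _)
  obtain ⟨κ, hκ, h⟩ := exists_pos_le_scalarCost_one hp
    (lt_min (by norm_num : (0 : ℝ) < 1 / 2) (by positivity : 0 < ε / (2 * R')))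
  set η := min (1 / 2) (ε / (2 * R'))
  -- M is the larger number. The alternatives both give m / M ≤ 1 - η, and M ≥ ε turns the factor M
  -- ^ p into ε ^ p.
  have key : ∀ M m, 0 ≤ m → ε ≤ M → m ≤ M → (m ≤ M / 2 ∨ (M ≤ 2 * R' ∧ ε ≤ M - m)) →
      ε ^ p * κ ≤ scalarCost p M m := by
    intro M m hm hM hmM hor
    have hM0 : 0 < M := by linarith
    have e : scalarCost p M m = M ^ p * scalarCost p 1 (m / M) := by
      rw [← scalarCost_mul hM0.le zero_le_one (by positivity)]
      congr 1
      · ring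
      · field_simp
    rw [e]
    have h2 : m / M ≤ 1 - η := by
      rw [div_le_iff₀ hM0]
      rcases hor with h3 | ⟨h3, h4⟩
      · have : η ≤ 1 / 2 := min_le_left _ _
        nlinarith
      · have h5 : η ≤ ε / (2 * R') := min_le_right _ _
        rw [le_div_iff₀ (by positivity)] at h5
        have h6 : 0 ≤ η := by positivity
        nlinarith
    have h3 := h (m / M) (by positivity) h2
    gcongr
  refine ⟨ε ^ p * κ, by positivity, fun r s hr hs hrR hrs => ?_⟩
  have hrR' : r ≤ R' := hrR.trans (le_max_left _ _)
  rcases le_total s r with hsr | hsr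
  · rw [abs_of_nonneg (by linarith)] at hrs
    exact key r s hs (by linarith) hsr (Or.inr ⟨by linarith, hrs⟩)
  · rw [abs_of_nonpos (by linarith)] at hrs
    rw [scalarCost_comm]
    refine key s r hr (by linarith) hsr ?_
    rcases le_total r (s / 2) with h1 | h1
    · exact Or.inl h1
    · exact Or.inr ⟨by linarith, by linarith⟩

/-- Clarkson's inequality for nonnegative scalars. -/
theorem abs_sub_rpow_le_scalarCost {p r s : ℝ} (hp : 2 ≤ p) (hr : 0 ≤ r) (hs : 0 ≤ s) :
    |r - s| ^ p ≤ scalarCost p r s := by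
  have hp2 : 1 ≤ p / 2 := by linarith
  have e : ∀ t : ℝ, |t| ^ p = (t ^ 2) ^ (p / 2) := fun t => by
    rw [← sq_abs, ← Real.rpow_natCast, ← Real.rpow_mul (abs_nonneg t)]
    congr 1
    push_cast
    ring
  -- Superadditivity of t ↦ t ^ (p / 2) on the squares of r + s and r - s; the parallelogram
  -- identity and convexity of the same power then conclude.
  have h1 := Real.add_rpow_le_rpow_add (sq_nonneg (r + s)) (sq_nonneg (r - s)) hp2
  have h2 := (convexOn_rpow hp2).2 (Set.mem_Ici.2 (sq_nonneg r)) (Set.mem_Ici.2 (sq_nonneg s))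
    (by norm_num : (0 : ℝ) ≤ 1 / 2)
    (by norm_num : (0 : ℝ) ≤ 1 / 2) (by norm_num)
  simp only [smul_eq_mul] at h2
  have h3 : (r + s) ^ 2 + (r - s) ^ 2 = 4 * (1 / 2 * r ^ 2 + 1 / 2 * s ^ 2) := by ring
  have h4 : (4 : ℝ) ^ (p / 2) = 2 * 2 ^ (p - 1) := by
    rw [← two_rpow_eq, show (4 : ℝ) = 2 ^ 2 by norm_num, ← e, abs_two]
  rw [h3, Real.mul_rpow (by norm_num) (by positivity), h4, ← e, ← e,
    abs_of_nonneg (add_nonneg hr hs)] at h1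
  rw [← e, ← e, abs_of_nonneg hr, abs_of_nonneg hs] at h2
  have h5 : 0 < (2 : ℝ) ^ (p - 1) := by positivity
  rw [scalarCost]
  nlinarith

/-- Follows from b ^ (p - 1) ≤ a ^ (p - 1); it converts a defect in the triangle inequality into a
defect of p-th powers. -/
theorem rpow_sub_one_mul_sub_le {p a b : ℝ} (hp : 1 ≤ p) (hb : 0 ≤ b) (hba : b ≤ a) :
    a ^ (p - 1) * (a - b) ≤ a ^ p - b ^ p := by
  rcases hb.eq_or_lt with rfl | hb0
  · rcases hba.eq_or_lt with rfl | ha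
    · simp
    · rw [Real.zero_rpow (by linarith), Real.rpow_sub_one ha.ne']
      field_simp
      simp [mul_comm]
  have ha : 0 < a := by linarith
  have h1 : a ^ p = a ^ (p - 1) * a := by
    rw [Real.rpow_sub_one ha.ne']; field_simp
  have h2 : b ^ p = b ^ (p - 1) * b := by
    rw [Real.rpow_sub_one hb0.ne']; field_simp
  have h3 : b ^ (p - 1) ≤ a ^ (p - 1) := Real.rpow_le_rpow hb hba (by linarith)
  rw [h1, h2]
  nlinarith

/-! ### The cost on a normed space -/

/-- The weighted power `2 ^ (p - 1) ‖x‖ ^ p` of the norm. -/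
noncomputable def powNorm (p : ℝ) (x : X) : ℝ := 2 ^ (p - 1) * ‖x‖ ^ p

/-- The defect of midpoint convexity of the `p`-th power of the norm. -/
noncomputable def cost (p : ℝ) (x y : X) : ℝ := powNorm p x + powNorm p y - ‖x + y‖ ^ p

theorem powNorm_nonneg (p : ℝ) (x : X) : 0 ≤ powNorm p x := by
  unfold powNorm; positivity

theorem continuous_powNorm {p : ℝ} (hp : 0 ≤ p) : Continuous (powNorm p : X → ℝ) :=
  continuous_const.mul (continuous_norm.rpow_const fun _ => Or.inr hp)

theorem convexOn_powNorm {p : ℝ} (hp : 1 ≤ p) : ConvexOn ℝ Set.univ (powNorm p : X → ℝ) := by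
  have h : ConvexOn ℝ Set.univ fun x : X => ‖x‖ ^ p := by
    refine ⟨convex_univ, fun x _ y _ a b ha hb hab => ?_⟩
    refine (Real.rpow_le_rpow (norm_nonneg _) ((convexOn_univ_norm (E := X)).2 (Set.mem_univ x)
      (Set.mem_univ y) ha hb hab) (by linarith)).trans ?_
    exact (convexOn_rpow hp).2 (Set.mem_Ici.2 (norm_nonneg x)) (Set.mem_Ici.2 (norm_nonneg y))
      ha hb hab
  have := h.smul (c := (2 : ℝ) ^ (p - 1)) (by positivity)
  exact this

/-- Both summands are nonnegative: the first controls the difference of the norms, the second the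
defect in the triangle inequality, hence the directions. -/
theorem cost_eq (p : ℝ) (x y : X) :
    cost p x y = scalarCost p ‖x‖ ‖y‖ + ((‖x‖ + ‖y‖) ^ p - ‖x + y‖ ^ p) := by
  unfold cost powNorm scalarCost; ring

theorem cost_comm (p : ℝ) (x y : X) : cost p x y = cost p y x := by
  unfold cost; rw [add_comm x y]; ring

theorem cost_self (p : ℝ) (x : X) : cost p x x = 0 := by
  have : ‖x + x‖ = 2 * ‖x‖ := by rw [← two_smul ℝ x, norm_smul]; simp
  rw [cost, powNorm, this, Real.mul_rpow zero_le_two (norm_nonneg x), two_rpow_eq p]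
  generalize (2 : ℝ) ^ (p - 1) = c
  ring

theorem norm_add_rpow_le {p : ℝ} (hp : 0 ≤ p) (x y : X) : ‖x + y‖ ^ p ≤ (‖x‖ + ‖y‖) ^ p :=
  Real.rpow_le_rpow (norm_nonneg _) (norm_add_le x y) hp

theorem scalarCost_le_cost {p : ℝ} (hp : 0 ≤ p) (x y : X) :
    scalarCost p ‖x‖ ‖y‖ ≤ cost p x y := by
  rw [cost_eq]; linarith [norm_add_rpow_le hp x y]

theorem sub_rpow_le_cost {p : ℝ} (hp : 1 ≤ p) (x y : X) :
    (‖x‖ + ‖y‖) ^ p - ‖x + y‖ ^ p ≤ cost p x y := by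
  rw [cost_eq]; linarith [scalarCost_nonneg hp (norm_nonneg x) (norm_nonneg y)]

theorem cost_nonneg {p : ℝ} (hp : 1 ≤ p) (x y : X) : 0 ≤ cost p x y :=
  (scalarCost_nonneg hp (norm_nonneg x) (norm_nonneg y)).trans
    (scalarCost_le_cost (by linarith) x y)

/-! ### Vanishing cost forces convergence -/

section Limits

variable {ι : Type*} {l : Filter ι} {x y : ι → X} {p r : ℝ}

theorem tendsto_norm_of_cost (hp : 1 < p) (hx : Tendsto (fun i => ‖x i‖) l (𝓝 r))
    (hc : Tendsto (fun i => cost p (x i) (y i)) l (𝓝 0)) :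
    Tendsto (fun i => ‖y i‖) l (𝓝 r) := by
  rw [Metric.tendsto_nhds] at hx ⊢
  intro ε hε
  obtain ⟨δ, hδ, h⟩ := exists_pos_le_scalarCost hp (r + 1) (half_pos hε)
  filter_upwards [hx _ (lt_min (half_pos hε) one_pos), hc.eventually_lt_const hδ] with i h1 h2
  rw [Real.dist_eq] at h1 ⊢
  have h3 := (lt_min_iff.1 h1).1
  have h4 := (lt_min_iff.1 h1).2
  by_contra! h5
  have h6 : ε / 2 ≤ |‖x i‖ - ‖y i‖| := by
    have := abs_sub_le ‖y i‖ ‖x i‖ r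
    rw [abs_sub_comm ‖y i‖ ‖x i‖] at this
    linarith
  have := h _ _ (norm_nonneg (x i)) (norm_nonneg (y i)) (by linarith [(abs_lt.1 h4).2]) h6
  linarith [scalarCost_le_cost (by linarith : 0 ≤ p) (x i) (y i)]

theorem tendsto_norm_add_of_cost (hp : 1 < p) (hx : Tendsto (fun i => ‖x i‖) l (𝓝 r))
    (hc : Tendsto (fun i => cost p (x i) (y i)) l (𝓝 0)) :
    Tendsto (fun i => ‖x i + y i‖) l (𝓝 (2 * r)) := by
  have hp0 : 0 < p := by linarith
  rcases l.eq_or_neBot with rfl | hl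
  · exact tendsto_bot
  have hr : 0 ≤ r := ge_of_tendsto' hx fun i => norm_nonneg _
  have hy := tendsto_norm_of_cost hp hx hc
  have h1 : Tendsto (fun i => (‖x i‖ + ‖y i‖) ^ p) l (𝓝 ((2 * r) ^ p)) := by
    rw [two_mul]
    exact (hx.add hy).rpow_const (Or.inr hp0.le)
  have h2 : Tendsto (fun i => (‖x i‖ + ‖y i‖) ^ p - ‖x i + y i‖ ^ p) l (𝓝 0) :=
    squeeze_zero (fun i => sub_nonneg.2 (norm_add_rpow_le hp0.le _ _))
      (fun i => sub_rpow_le_cost hp.le _ _) hc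
  have h3 : Tendsto (fun i => ‖x i + y i‖ ^ p) l (𝓝 ((2 * r) ^ p)) := by
    simpa using h1.sub h2
  have h4 := h3.rpow_const (p := p⁻¹) (Or.inr (by positivity))
  simpa [Real.rpow_rpow_inv, hp0.ne', hr] using h4

/-- Normalizing to the unit sphere reduces this to local uniform convexity at x₀ / ‖x₀‖; the
normalization errors vanish because the norms converge. -/
theorem tendsto_of_tendsto_norm_add (hLUC : LocallyUniformlyConvex X) {x₀ : X}
    (hy : Tendsto (fun i => ‖y i‖) l (𝓝 ‖x₀‖))
    (hxy : Tendsto (fun i => ‖x₀ + y i‖) l (𝓝 (2 * ‖x₀‖))) : Tendsto y l (𝓝 x₀) := by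
  rcases eq_or_ne x₀ 0 with rfl | hx0
  · rw [norm_zero] at hy
    exact tendsto_zero_iff_norm_tendsto_zero.2 hy
  have hr : 0 < ‖x₀‖ := norm_pos_iff.2 hx0
  set r := ‖x₀‖ with hrdef
  have hscale : Tendsto (fun i => ‖(r⁻¹ - ‖y i‖⁻¹) • y i‖) l (𝓝 0) := by
    have h1 : Tendsto (fun i => |r⁻¹ - ‖y i‖⁻¹| * ‖y i‖) l (𝓝 (|r⁻¹ - r⁻¹| * r)) :=
      ((tendsto_const_nhds.sub (hy.inv₀ hr.ne')).abs).mul hy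
    simpa [norm_smul] using h1
  have hsum : Tendsto (fun i => ‖r⁻¹ • x₀ + ‖y i‖⁻¹ • y i‖) l (𝓝 2) := by
    have h1 : Tendsto (fun i => r⁻¹ * ‖x₀ + y i‖ - ‖(r⁻¹ - ‖y i‖⁻¹) • y i‖) l
        (𝓝 (r⁻¹ * (2 * r) - 0)) := (hxy.const_mul _).sub hscale
    have h2 : Tendsto (fun i => r⁻¹ * ‖x₀ + y i‖ + ‖(r⁻¹ - ‖y i‖⁻¹) • y i‖) l
        (𝓝 (r⁻¹ * (2 * r) + 0)) := (hxy.const_mul _).add hscale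
    have e : r⁻¹ * (2 * r) = 2 := by field_simp
    rw [e] at h1 h2
    rw [sub_zero] at h1
    rw [add_zero] at h2
    have hn : ∀ i, r⁻¹ * ‖x₀ + y i‖ = ‖r⁻¹ • (x₀ + y i)‖ := fun i => by
      rw [norm_smul, Real.norm_of_nonneg (by positivity)]
    have hd : ∀ i, r⁻¹ • x₀ + ‖y i‖⁻¹ • y i
        = r⁻¹ • (x₀ + y i) - (r⁻¹ - ‖y i‖⁻¹) • y i := fun i => by
      rw [sub_smul, smul_add]; abel
    refine tendsto_of_tendsto_of_tendsto_of_le_of_le h1 h2 (fun i => ?_) (fun i => ?_)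
    · simp only [hn, hd]
      exact norm_sub_norm_le _ _
    · simp only [hn, hd]
      exact norm_sub_le _ _
  have hdir : Tendsto (fun i => ‖r⁻¹ • x₀ - ‖y i‖⁻¹ • y i‖) l (𝓝 0) := by
    rw [Metric.tendsto_nhds]
    intro ε hε
    obtain ⟨δ, hδ, h⟩ := hLUC (r⁻¹ • x₀) (by rw [norm_smul, norm_inv, norm_norm]; field_simp) ε hε
    filter_upwards [hsum.eventually_const_lt (by linarith : 2 - δ < 2),
      hy.eventually_const_lt hr] with i h1 h2
    rw [dist_zero_right, norm_norm]
    by_contra! h3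
    have := h (‖y i‖⁻¹ • y i) (by rw [norm_smul, norm_inv, norm_norm]; field_simp) h3
    linarith
  rw [tendsto_iff_norm_sub_tendsto_zero]
  have hlim : Tendsto (fun i => r * (‖r⁻¹ • x₀ - ‖y i‖⁻¹ • y i‖
      + ‖(r⁻¹ - ‖y i‖⁻¹) • y i‖)) l (𝓝 0) := by
    simpa using (hdir.add hscale).const_mul r
  refine squeeze_zero (fun i => norm_nonneg _) (fun i => ?_) hlim
  have e : y i - x₀ = r • (-(r⁻¹ • x₀ - ‖y i‖⁻¹ • y i) + (r⁻¹ - ‖y i‖⁻¹) • y i) := by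
    rw [neg_sub, sub_smul]
    have : y i - x₀ = r • (r⁻¹ • (y i - x₀)) := by rw [smul_inv_smul₀ hr.ne']
    rw [this]
    congr 1
    rw [smul_sub]; abel
  rw [e, norm_smul, Real.norm_of_nonneg hr.le]
  gcongr
  refine (norm_add_le _ _).trans ?_
  rw [norm_neg]

theorem tendsto_of_cost (hLUC : LocallyUniformlyConvex X) (hp : 1 < p) {x₀ : X}
    (hx : Tendsto x l (𝓝 x₀)) (hc : Tendsto (fun i => cost p (x i) (y i)) l (𝓝 0)) :
    Tendsto y l (𝓝 x₀) := by
  refine tendsto_of_tendsto_norm_add hLUC (tendsto_norm_of_cost hp hx.norm hc) ?_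
  have h1 := tendsto_norm_add_of_cost hp hx.norm hc
  have h2 : Tendsto (fun i => ‖x₀ - x i‖) l (𝓝 0) := by
    have := tendsto_iff_norm_sub_tendsto_zero.1 hx
    simpa [norm_sub_rev] using this
  refine tendsto_of_tendsto_of_tendsto_of_le_of_le (by simpa using h1.sub h2)
    (by simpa using h1.add h2) (fun i => ?_) (fun i => ?_)
  · have := norm_sub_le (x₀ + y i) (x₀ - x i)
    simp only
    rw [show x i + y i = (x₀ + y i) - (x₀ - x i) by abel]
    linarith
  · simp only
    rw [show x₀ + y i = (x i + y i) + (x₀ - x i) by abel]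
    exact norm_add_le _ _

theorem tendsto_sub_of_cost [UniformConvexSpace X] (hp : 1 < p)
    (hx : Tendsto (fun i => ‖x i‖) l (𝓝 r))
    (hc : Tendsto (fun i => cost p (x i) (y i)) l (𝓝 0)) :
    Tendsto (fun i => ‖y i - x i‖) l (𝓝 0) := by
  rcases l.eq_or_neBot with rfl | hl
  · exact tendsto_bot
  have hr : 0 ≤ r := ge_of_tendsto' hx fun i => norm_nonneg _
  have hy := tendsto_norm_of_cost hp hx hc
  have hxy := tendsto_norm_add_of_cost hp hx hc
  rcases hr.eq_or_lt with rfl | hr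
  · refine squeeze_zero (fun i => norm_nonneg _) (fun i => norm_sub_le _ _) ?_
    simpa using hy.add hx
  have hscale : ∀ w : ι → X, Tendsto (fun i => ‖w i‖) l (𝓝 r) →
      Tendsto (fun i => ‖w i - (r * ‖w i‖⁻¹) • w i‖) l (𝓝 0) := by
    intro w hw
    have h1 : Tendsto (fun i => |1 - r * ‖w i‖⁻¹| * ‖w i‖) l (𝓝 (|1 - r * r⁻¹| * r)) :=
      ((tendsto_const_nhds.sub ((hw.inv₀ hr.ne').const_mul r)).abs).mul hw
    have e : |1 - r * r⁻¹| * r = 0 := by rw [mul_inv_cancel₀ hr.ne']; simp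
    rw [e] at h1
    refine h1.congr fun i => ?_
    rw [← Real.norm_eq_abs, ← norm_smul, sub_smul, one_smul]
  -- This includes w = 0, where the inverse of the norm is 0 by convention; so the retracted points
  -- always lie in the ball of radius r, where uniform convexity applies.
  have hball : ∀ w : X, ‖(r * ‖w‖⁻¹) • w‖ ≤ r := by
    intro w
    rw [norm_smul, Real.norm_of_nonneg (by positivity), mul_assoc]
    exact mul_le_of_le_one_right hr.le inv_mul_le_one
  have hsx := hscale x hx
  have hsy := hscale y hy
  have hdiff : Tendsto (fun i => ‖(r * ‖x i‖⁻¹) • x i - (r * ‖y i‖⁻¹) • y i‖) l (𝓝 0) := by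
    rw [Metric.tendsto_nhds]
    intro ε hε
    obtain ⟨δ, hδ, h⟩ := exists_forall_closed_ball_dist_add_le_two_mul_sub X hε r
    have hlow : Tendsto (fun i => ‖x i + y i‖ - (‖x i - (r * ‖x i‖⁻¹) • x i‖
        + ‖y i - (r * ‖y i‖⁻¹) • y i‖)) l (𝓝 (2 * r)) := by
      simpa using hxy.sub (hsx.add hsy)
    filter_upwards [hlow.eventually_const_lt (by linarith : 2 * r - δ < 2 * r)] with i h1
    rw [dist_zero_right, norm_norm]
    by_contra! h2
    have h3 := h (hball (x i)) (hball (y i)) h2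
    have h4 : ‖x i + y i‖ ≤ ‖(r * ‖x i‖⁻¹) • x i + (r * ‖y i‖⁻¹) • y i‖
        + (‖x i - (r * ‖x i‖⁻¹) • x i‖ + ‖y i - (r * ‖y i‖⁻¹) • y i‖) := by
      have e : x i + y i = ((r * ‖x i‖⁻¹) • x i + (r * ‖y i‖⁻¹) • y i)
          + ((x i - (r * ‖x i‖⁻¹) • x i) + (y i - (r * ‖y i‖⁻¹) • y i)) := by abel
      calc ‖x i + y i‖ = _ := congrArg _ e
        _ ≤ _ := (norm_add_le _ _).trans (by gcongr; exact norm_add_le _ _)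
    linarith
  refine squeeze_zero (fun i => norm_nonneg _) (fun i => ?_)
    (by simpa using (hsx.add hsy).add hdiff)
  have e : y i - x i = (-(x i - (r * ‖x i‖⁻¹) • x i) + (y i - (r * ‖y i‖⁻¹) • y i))
      + -((r * ‖x i‖⁻¹) • x i - (r * ‖y i‖⁻¹) • y i) := by abel
  calc ‖y i - x i‖ = _ := congrArg _ e
    _ ≤ _ := (norm_add_le _ _).trans (add_le_add (norm_add_le _ _) le_rfl)
    _ = _ := by rw [norm_neg, norm_neg]

end Limits

/-! ### Two-step chains of small cost -/

/-- Chains of two steps of small cost that start in `K` end near their starting point. -/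
def CostControlled (p : ℝ) (K : Set X) : Prop :=
  ∀ ε : ℝ, 0 < ε → ∃ δ : ℝ, 0 < δ ∧ ∀ x ∈ K, ∀ z y : X,
    cost p x z < δ → cost p z y < δ → ‖y - x‖ < ε

theorem costControlled_of_seq {p : ℝ} (hp : 1 ≤ p) {K : Set X}
    (h : ∀ x z y : ℕ → X, (∀ k, x k ∈ K) → Tendsto (fun k => cost p (x k) (z k)) atTop (𝓝 0) →
      Tendsto (fun k => cost p (z k) (y k)) atTop (𝓝 0) →
      ∃ φ : ℕ → ℕ, Tendsto (fun k => ‖y (φ k) - x (φ k)‖) atTop (𝓝 0)) :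
    CostControlled p K := by
  intro ε hε
  by_contra! hcon
  choose x hxK z y hxz hzy hyx using fun k : ℕ =>
    hcon (1 / ((k : ℝ) + 1)) (by positivity)
  have hlim := tendsto_one_div_add_atTop_nhds_zero_nat (𝕜 := ℝ)
  obtain ⟨φ, hφ⟩ := h x z y hxK
    (squeeze_zero (fun k => cost_nonneg hp _ _) (fun k => (hxz k).le) hlim)
    (squeeze_zero (fun k => cost_nonneg hp _ _) (fun k => (hzy k).le) hlim)
  obtain ⟨k, hk⟩ := (hφ.eventually_lt_const hε).exists
  exact absurd (hyx (φ k)) (not_le.2 hk)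

/-- Starting points converge along a subsequence; the middle points and then the end points must
follow to the same limit. -/
theorem costControlled_of_isCompact (hLUC : LocallyUniformlyConvex X) {p : ℝ} (hp : 1 < p)
    {K : Set X} (hK : IsCompact K) : CostControlled p K := by
  refine costControlled_of_seq hp.le fun x z y hx hxz hzy => ?_
  obtain ⟨x₀, -, φ, hφ, hlim⟩ := hK.tendsto_subseq hx
  refine ⟨φ, ?_⟩
  have hz := tendsto_of_cost hLUC hp hlim (hxz.comp hφ.tendsto_atTop)
  have hy := tendsto_of_cost hLUC hp hz (hzy.comp hφ.tendsto_atTop)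
  simpa using (hy.sub hlim).norm

/-- Only the norms of the starting points converge along a subsequence, but that suffices for a
uniformly convex norm. -/
theorem costControlled_of_isBounded [UniformConvexSpace X] {p : ℝ} (hp : 1 < p)
    {K : Set X} (hK : Bornology.IsBounded K) : CostControlled p K := by
  refine costControlled_of_seq hp.le fun x z y hx hxz hzy => ?_
  obtain ⟨R, hR⟩ := hK.exists_norm_le
  obtain ⟨r, -, φ, hφ, hlim⟩ := (isCompact_Icc (a := (0 : ℝ)) (b := R)).tendsto_subseq
    (x := fun k => ‖x k‖) fun k => ⟨norm_nonneg _, hR _ (hx k)⟩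
  refine ⟨φ, ?_⟩
  have hxz' := hxz.comp hφ.tendsto_atTop
  have h1 := tendsto_sub_of_cost (x := x ∘ φ) (y := z ∘ φ) hp hlim hxz'
  have h2 := tendsto_sub_of_cost (x := z ∘ φ) (y := y ∘ φ) hp
    (tendsto_norm_of_cost (x := x ∘ φ) hp hlim hxz') (hzy.comp hφ.tendsto_atTop)
  refine squeeze_zero (fun k => norm_nonneg _) (fun k => ?_) (by simpa using h2.add h1)
  have e : y (φ k) - x (φ k) = (y (φ k) - z (φ k)) + (z (φ k) - x (φ k)) := by abel
  rw [e]
  exact norm_add_le _ _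

/-- If the modulus of convexity is of power type `p`, then `‖·‖ ^ p` is `p`-uniformly convex. -/
theorem exists_mul_norm_sub_rpow_le_cost {p : ℝ} (hp : 2 ≤ p) (hC : ConvexityPowerType X p) :
    ∃ C : ℝ, 0 < C ∧ ∀ x y : X, C * ‖x - y‖ ^ p ≤ cost p x y := by
  obtain ⟨C, hC0, hC⟩ := hC
  have hp1 : 1 ≤ p := by linarith
  have hp0 : 0 < p := by linarith
  have hsphere : ∀ u v : X, ‖u‖ = 1 → ‖v‖ = 1 → ‖u + v‖ ≤ 2 - 2 * (C * ‖u - v‖ ^ p) := by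
    intro u v hu hv
    have h2 : ‖u + v‖ ≤ 2 := (norm_add_le u v).trans (by rw [hu, hv]; norm_num)
    rcases (norm_nonneg (u - v)).eq_or_lt with h0 | h0
    · rw [← h0, Real.zero_rpow hp0.ne']; simpa using h2
    have h3 := (hC ‖u - v‖ h0 ((norm_sub_le u v).trans (by rw [hu, hv]; norm_num))).trans
      (sInf_le ⟨u, v, hu, hv, le_rfl, rfl⟩ : convexityModulus X ‖u - v‖ ≤ _)
    rw [EReal.coe_le_coe_iff, norm_smul] at h3
    norm_num at h3
    linarith
  have key : ∀ x y : X, ‖y‖ ≤ ‖x‖ →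
      min 1 (2 * C) * (2 ^ (p - 1))⁻¹ * ‖x - y‖ ^ p ≤ cost p x y := by
    intro x y hyx
    set r := ‖x‖ with hr
    set s := ‖y‖ with hs
    -- w is x shrunk to the length of y. The radial part x - w is paid for by the scalar cost, and w
    -- - y, joining points of one sphere, by the triangle defect.
    set w := (s * r⁻¹) • x with hw
    have hr0 : 0 ≤ r := norm_nonneg x
    have hs0 : 0 ≤ s := norm_nonneg y
    have hxw : ‖x - w‖ = r - s := by
      rcases hr0.eq_or_lt with h0 | h0
      · have this_x : x = 0 := norm_eq_zero.1 h0.symm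
        have h_s : s = 0 := by linarith
        simpa [this_x, hw, h_s] using h0
      · have : x - w = (1 - s * r⁻¹) • x := by rw [hw, sub_smul, one_smul]
        rw [this, norm_smul, Real.norm_of_nonneg, ← hr]
        · field_simp
        · rw [sub_nonneg, ← div_eq_mul_inv]; exact div_le_one_of_le₀ hyx hr0
    have hadd : ‖x + y‖ ≤ r + s - 2 * (s * (C * (‖w - y‖ / s) ^ p)) := by
      have h1 : ‖w + y‖ ≤ 2 * s - 2 * (s * (C * (‖w - y‖ / s) ^ p)) := by
        rcases hs0.eq_or_lt with h0 | h0
        · have : y = 0 := norm_eq_zero.1 h0.symm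
          simp [hw, ← h0, this]
        have hr1 : 0 < r := by linarith
        have hu : ‖r⁻¹ • x‖ = 1 := by rw [norm_smul, norm_inv, Real.norm_of_nonneg hr0, ← hr]
                                      field_simp
        have hv : ‖s⁻¹ • y‖ = 1 := by rw [norm_smul, norm_inv, Real.norm_of_nonneg hs0, ← hs]
                                      field_simp
        have h2 := hsphere _ _ hu hv
        have e1 : w + y = s • (r⁻¹ • x + s⁻¹ • y) := by
          rw [hw, smul_add, smul_inv_smul₀ h0.ne', mul_smul]
        have e2 : w - y = s • (r⁻¹ • x - s⁻¹ • y) := by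
          rw [hw, smul_sub, smul_inv_smul₀ h0.ne', mul_smul]
        rw [e1, e2, norm_smul, norm_smul, Real.norm_of_nonneg hs0, mul_div_cancel_left₀ _ h0.ne']
        nlinarith
      have h2 : ‖x + y‖ ≤ ‖x - w‖ + ‖w + y‖ := by
        rw [show x + y = (x - w) + (w + y) by abel]; exact norm_add_le _ _
      linarith
    -- The factor (r + s) ^ (p - 1) ≥ s ^ (p - 1) compensates the power of s lost in rescaling to
    -- the unit sphere.
    have hB : 2 * C * ‖w - y‖ ^ p ≤ (r + s) ^ p - ‖x + y‖ ^ p := by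
      have h1 := rpow_sub_one_mul_sub_le hp1 (norm_nonneg (x + y)) (norm_add_le x y)
      refine le_trans ?_ h1
      have h2 : s ^ (p - 1) ≤ (r + s) ^ (p - 1) :=
        Real.rpow_le_rpow hs0 (by linarith) (by linarith)
      have h3 : 2 * (s * (C * (‖w - y‖ / s) ^ p)) ≤ r + s - ‖x + y‖ := by linarith
      have h4 : 0 ≤ 2 * (s * (C * (‖w - y‖ / s) ^ p)) := by positivity
      refine le_trans ?_ (mul_le_mul h2 h3 h4 (by positivity))
      rcases hs0.eq_or_lt with h0 | h0
      · have : y = 0 := norm_eq_zero.1 h0.symm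
        simp [hw, ← h0, this, hp0.ne']
      · rw [Real.div_rpow (norm_nonneg _) hs0, Real.rpow_sub_one h0.ne']
        have : 0 < s ^ p := by positivity
        field_simp
        exact le_rfl
    have hA : (r - s) ^ p ≤ scalarCost p r s := by
      have := abs_sub_rpow_le_scalarCost hp hr0 hs0
      rwa [abs_of_nonneg (by linarith)] at this
    have hxy : ‖x - y‖ ^ p ≤ 2 ^ (p - 1) * ((r - s) ^ p + ‖w - y‖ ^ p) := by
      have h1 : ‖x - y‖ ≤ (r - s) + ‖w - y‖ := by
        rw [← hxw, show x - y = (x - w) + (w - y) by abel]; exact norm_add_le _ _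
      refine (Real.rpow_le_rpow (norm_nonneg _) h1 hp0.le).trans ?_
      have := scalarCost_nonneg hp1 (by linarith : 0 ≤ r - s) (norm_nonneg (w - y))
      unfold scalarCost at this
      linarith
    have h2p : (0 : ℝ) < 2 ^ (p - 1) := by positivity
    rw [cost_eq, mul_assoc]
    have h5 : (2 ^ (p - 1))⁻¹ * ‖x - y‖ ^ p ≤ (r - s) ^ p + ‖w - y‖ ^ p := by
      rw [inv_mul_le_iff₀ h2p]; exact hxy
    have hm : 0 < min 1 (2 * C) := by positivity
    have h6 : 0 ≤ (r - s) ^ p := Real.rpow_nonneg (by linarith) p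
    have h7 : 0 ≤ ‖w - y‖ ^ p := by positivity
    calc _ ≤ min 1 (2 * C) * ((r - s) ^ p + ‖w - y‖ ^ p) := by gcongr
      _ ≤ 1 * (r - s) ^ p + 2 * C * ‖w - y‖ ^ p := by
        rw [mul_add]
        gcongr
        · exact min_le_left _ _
        · exact min_le_right _ _
      _ ≤ _ := by linarith
  refine ⟨min 1 (2 * C) * (2 ^ (p - 1))⁻¹, by positivity, fun x y => ?_⟩
  rcases le_total ‖y‖ ‖x‖ with h | h
  · exact key x y h
  · rw [cost_comm, norm_sub_rev]; exact key y x h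

/-! ### Subgradients and real-valued convex envelopes -/

/-- Separate (x, G x) from the open strict epigraph; the functional is positive in the vertical
direction, so it can be normalized there. -/
theorem exists_subgradient {G : X → ℝ} (hG : ConvexOn ℝ Set.univ G) (hc : Continuous G) (x : X) :
    ∃ ℓ : X →L[ℝ] ℝ, ∀ z, G x + ℓ (z - x) ≤ G z := by
  have hconv : Convex ℝ {q : X × ℝ | G q.1 < q.2} := by
    simpa using hG.convex_strict_epigraph
  have hopen : IsOpen {q : X × ℝ | G q.1 < q.2} :=
    isOpen_lt (hc.comp continuous_fst) continuous_snd
  obtain ⟨L, hL⟩ := geometric_hahn_banach_point_open hconv hopen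
    (x := (x, G x)) (by simp)
  have hsplit : ∀ (z : X) (t : ℝ), L (z, t) = L (z, 0) + L (0, 1) * t := by
    intro z t
    have : ((z, t) : X × ℝ) = (z, 0) + t • (0, 1) := by simp
    rw [this, map_add, map_smul, smul_eq_mul, mul_comm]
  have hpos : 0 < L (0, 1) := by
    have := hL (x, G x + 1) (by simp)
    rw [hsplit, hsplit x (G x + 1)] at this
    nlinarith
  set c := L (0, 1)
  refine ⟨-c⁻¹ • L.comp (.inl ℝ X ℝ), fun z => ?_⟩
  have hz : L (x, 0) + c * G x ≤ L (z, 0) + c * G z := by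
    refine le_of_forall_pos_le_add fun ε hε => ?_
    have := hL (z, G z + ε / c) (by simp; positivity)
    rw [hsplit, hsplit z (G z + ε / c), mul_add, mul_div_cancel₀ _ hpos.ne'] at this
    linarith
  have hzx : L (z - x, 0) = L (z, 0) - L (x, 0) := by
    rw [← map_sub]; simp
  have hval : (-c⁻¹ • L.comp (.inl ℝ X ℝ)) (z - x) = -c⁻¹ * (L (z, 0) - L (x, 0)) := by
    rw [← hzx]; simp
  rw [hval]
  have : c * (G x + -c⁻¹ * (L (z, 0) - L (x, 0))) ≤ c * G z := by
    have e : c * (G x + -c⁻¹ * (L (z, 0) - L (x, 0))) = c * G x - (L (z, 0) - L (x, 0)) := by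
      field_simp
      ring
    rw [e]; linarith
  exact le_of_mul_le_mul_left this hpos

theorem coe_mem_convexMinorants {g : X → EReal} {k : X → ℝ} (hk : ConvexOn ℝ Set.univ k)
    (hkc : Continuous k) (hkg : ∀ x, (k x : EReal) ≤ g x) :
    (fun x => (k x : EReal)) ∈ convexMinorants g := by
  refine ⟨⟨fun x => EReal.coe_ne_bot _, 0, EReal.coe_ne_top _⟩, ?_, ?_, hkg⟩
  · have := hk.convex_epigraph
    simpa [ConvexFun] using this
  · exact (continuous_coe_real_ereal.comp hkc).lowerSemicontinuous

/-- Lying between the finite functions k and u makes the envelope finite; being convex and locally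
bounded above makes it continuous. -/
theorem exists_real_convexEnvelope {g : X → EReal} {u k : X → ℝ} (hu : Continuous u)
    (hgu : ∀ x, g x ≤ u x) (hk : ConvexOn ℝ Set.univ k) (hkc : Continuous k)
    (hkg : ∀ x, (k x : EReal) ≤ g x) :
    ∃ G : X → ℝ, (∀ x, convexEnvelope g x = G x) ∧ ConvexOn ℝ Set.univ G ∧ Continuous G ∧
      (∀ x, (G x : EReal) ≤ g x) ∧ ∀ k' : X → ℝ, ConvexOn ℝ Set.univ k' → Continuous k' →
        (∀ x, (k' x : EReal) ≤ g x) → ∀ x, k' x ≤ G x := by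
  obtain ⟨⟨hprop, hconv, -, hle⟩, hub⟩ := convexEnvelope_isGreatest g
    ⟨0, ((hgu 0).trans_lt (EReal.coe_lt_top _)).ne⟩ ⟨_, coe_mem_convexMinorants hk hkc hkg⟩
  have hG : ∀ x, convexEnvelope g x = ((convexEnvelope g x).toReal : EReal) := fun x =>
    (EReal.coe_toReal (((hle x).trans (hgu x)).trans_lt (EReal.coe_lt_top _)).ne
      (hprop.1 x)).symm
  set G : X → ℝ := fun x => (convexEnvelope g x).toReal with hGdef
  have hGc : ConvexOn ℝ Set.univ G := by
    refine ⟨convex_univ, fun x _ y _ a b ha hb hab => ?_⟩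
    have := hconv (x := (x, G x)) (hG x).le (y := (y, G y)) (hG y).le ha hb hab
    simp only [Set.mem_ofPred_eq, Prod.smul_mk, Prod.mk_add_mk] at this
    rw [hG, EReal.coe_le_coe_iff] at this
    exact this
  have hGu : ∀ x, G x ≤ u x := fun x => by
    have := (hle x).trans (hgu x)
    rwa [hG, EReal.coe_le_coe_iff] at this
  refine ⟨G, hG, hGc, ?_, fun x => (hG x).ge.trans (hle x), fun k' h1 h2 h3 x => ?_⟩
  · rw [← continuousOn_univ]
    refine ((hGc.continuousOn_tfae isOpen_univ Set.univ_nonempty).out 1 3).2 ?_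
    refine ⟨0, Set.mem_univ _, ?_⟩
    exact (hu.tendsto 0).isBoundedUnder_le.mono_le (Eventually.of_forall hGu)
  · have := hub (coe_mem_convexMinorants h1 h2 h3) x
    rwa [hG, EReal.coe_le_coe_iff] at this

/-! ### The envelope of the approximating functions -/

/-- The value `r + n c(x, y) + n φ(x)` of the function minimized in `gApprox`, where `r = f y`. -/
noncomputable def penalized (p : ℝ) (n : ℕ) (r : ℝ) (x y : X) : ℝ :=
  r + n * cost p x y + n * powNorm p x

theorem gApprox_term (p : ℝ) (n : ℕ) (r : ℝ) (x y : X) :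
    (r : EReal) + (((2 : ℝ) ^ (p - 1) * n * ‖x‖ ^ p + (2 : ℝ) ^ (p - 1) * n * ‖y‖ ^ p
      - n * ‖x + y‖ ^ p : ℝ) : EReal) + (((2 : ℝ) ^ (p - 1) * n * ‖x‖ ^ p : ℝ) : EReal)
      = (penalized p n r x y : EReal) := by
  rw [← EReal.coe_add, ← EReal.coe_add, EReal.coe_eq_coe_iff, penalized, cost, powNorm, powNorm]
  ring

theorem gApprox_le {f : X → EReal} {p : ℝ} {n : ℕ} {y : X} {r : ℝ} (hy : f y = r) (x : X) :
    gApprox p n f x ≤ (penalized p n r x y : EReal) := by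
  rw [← gApprox_term, ← hy, gApprox]
  gcongr
  exact iInf_le (fun y => f y + (((2 : ℝ) ^ (p - 1) * n * ‖x‖ ^ p
    + (2 : ℝ) ^ (p - 1) * n * ‖y‖ ^ p - n * ‖x + y‖ ^ p : ℝ) : EReal)) y

/-- Points where f is +∞ contribute +∞ to the infimum, so only finite values need testing. -/
theorem le_gApprox {f : X → EReal} (hf : ∀ y, f y ≠ ⊥) {p : ℝ} {n : ℕ} {x : X} {a : ℝ}
    (h : ∀ (y : X) (r : ℝ), f y = r → a ≤ penalized p n r x y) :
    (a : EReal) ≤ gApprox p n f x := by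
  rw [gApprox]
  set c : ℝ := 2 ^ (p - 1) * n * ‖x‖ ^ p with hc
  have e : (a : EReal) = ((a - c : ℝ) : EReal) + (c : EReal) := by
    rw [← EReal.coe_add]; simp
  rw [e]
  gcongr
  refine le_iInf fun y => ?_
  rcases eq_or_ne (f y) ⊤ with hy | hy
  · rw [hy, EReal.top_add_coe]; exact le_top
  · have hr := (EReal.coe_toReal hy (hf y)).symm
    have h1 := h y _ hr
    rw [hr, ← EReal.coe_add, EReal.coe_le_coe_iff]
    have h2 := gApprox_term p n (f y).toReal x y
    rw [← EReal.coe_add, ← EReal.coe_add, EReal.coe_eq_coe_iff] at h2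
    linarith

/-- `G` is the real-valued convex envelope of `gApprox p n f`. -/
structure IsEnvelope (p : ℝ) (n : ℕ) (f : X → EReal) (G : X → ℝ) : Prop where
  deltaApprox_eq : ∀ x, deltaApprox p n f x = ((G x - n * powNorm p x : ℝ) : EReal)
  convexOn : ConvexOn ℝ Set.univ G
  continuous : Continuous G
  le_penalized : ∀ (x y : X) (r : ℝ), f y = r → G x ≤ penalized p n r x y
  le_of_le_penalized : ∀ k : X → ℝ, ConvexOn ℝ Set.univ k → Continuous k →
    (∀ (x y : X) (r : ℝ), f y = r → k x ≤ penalized p n r x y) → ∀ x, k x ≤ G x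

theorem convexOn_affine (a : ℝ) (ℓ : X →L[ℝ] ℝ) (x : X) :
    ConvexOn ℝ Set.univ fun z => a + ℓ (z - x) := by
  refine ⟨convex_univ, fun y _ z _ s t hs ht hst => le_of_eq ?_⟩
  simp only [map_sub, map_add, map_smul, smul_eq_mul]
  linear_combination (ℓ x - a) * hst

theorem continuous_penalized {p : ℝ} (hp : 0 ≤ p) (n : ℕ) (r : ℝ) (y : X) :
    Continuous fun x : X => penalized p n r x y := by
  have h1 := continuous_powNorm (X := X) hp
  have h2 : Continuous fun x : X => ‖x + y‖ ^ p :=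
    (continuous_id.add continuous_const).norm.rpow_const fun _ => Or.inr hp
  unfold penalized cost
  fun_prop

theorem exists_isEnvelope {p : ℝ} (hp : 0 ≤ p) {n : ℕ} {f : X → EReal} (hf : Proper f) {k : X → ℝ}
    (hk : ConvexOn ℝ Set.univ k) (hkc : Continuous k)
    (hkf : ∀ (x y : X) (r : ℝ), f y = r → k x ≤ penalized p n r x y) :
    ∃ G, IsEnvelope p n f G := by
  obtain ⟨hbot, y₀, hy₀⟩ := hf
  have hr₀ := (EReal.coe_toReal hy₀ (hbot y₀)).symm
  obtain ⟨G, hG, h1, h2, h3, h4⟩ := exists_real_convexEnvelope (continuous_penalized hp n _ y₀)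
    (gApprox_le (n := n) hr₀) hk hkc fun x => le_gApprox hbot (hkf x)
  refine ⟨G, fun x => ?_, h1, h2, fun x y r hy => ?_, fun k' h5 h6 h7 => ?_⟩
  · rw [deltaApprox, hG, ← EReal.coe_sub, powNorm]
    congr 2
    ring
  · rw [← EReal.coe_le_coe_iff]
    exact (h3 x).trans (gApprox_le hy x)
  · exact h4 k' h5 h6 fun x => le_gApprox hbot (h7 x)

/-- The subgradient inequality for `powNorm` improves itself by the cost. -/
theorem exists_powNorm_add_cost_le {p : ℝ} (hp : 1 ≤ p) (x : X) :
    ∃ ℓ : X →L[ℝ] ℝ, ∀ z, powNorm p x + ℓ (z - x) + cost p x z ≤ powNorm p z := by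
  obtain ⟨ℓ, hℓ⟩ := exists_subgradient (convexOn_powNorm hp)
    (continuous_powNorm (X := X) (by linarith : 0 ≤ p)) x
  refine ⟨ℓ, fun z => ?_⟩
  -- At the midpoint 2 φ((x + z) / 2) = ‖x + z‖ ^ p = φ(x) + φ(z) - c(x, z), which is where the
  -- extra cost term comes from.
  have h := hℓ ((2⁻¹ : ℝ) • (x + z))
  have e : (2⁻¹ : ℝ) • (x + z) - x = (2⁻¹ : ℝ) • (z - x) := by
    module
  have hn : 2 * powNorm p ((2⁻¹ : ℝ) • (x + z)) = ‖x + z‖ ^ p := by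
    rw [powNorm, norm_smul, Real.mul_rpow (norm_nonneg _) (norm_nonneg _), ← mul_assoc,
      ← mul_assoc, ← two_rpow_eq p, ← Real.mul_rpow zero_le_two (norm_nonneg _)]
    norm_num
  rw [e, map_smul, smul_eq_mul] at h
  rw [cost]
  linarith

/-- The slope is n times a subgradient of φ at x. The improved subgradient inequality lets n φ(z)
supply the term n c(x, z), so the hypothesis involves a chain from x through z to y. -/
theorem exists_affine_le_penalized {p : ℝ} (hp : 1 ≤ p) {n : ℕ} {f : X → EReal} {x : X} {a : ℝ}
    (h : ∀ (y z : X) (r : ℝ), f y = r → a ≤ r + n * (cost p z y + cost p x z)) :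
    ∃ ℓ : X →L[ℝ] ℝ, ∀ (z y : X) (r : ℝ), f y = r →
      a + n * powNorm p x + ℓ (z - x) ≤ penalized p n r z y := by
  obtain ⟨ℓ, hℓ⟩ := exists_powNorm_add_cost_le hp x
  refine ⟨(n : ℝ) • ℓ, fun z y r hy => ?_⟩
  have h1 := h y z r hy
  have h2 := mul_le_mul_of_nonneg_left (hℓ z) (Nat.cast_nonneg (α := ℝ) n)
  simp only [smul_apply, smul_eq_mul, penalized]
  linarith

theorem exists_isEnvelope_of_le {p : ℝ} (hp : 1 ≤ p) {n : ℕ} {f : X → EReal} (hf : Proper f)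
    {x : X} {a : ℝ}
    (h : ∀ (y z : X) (r : ℝ), f y = r → a ≤ r + n * (cost p z y + cost p x z)) :
    ∃ G, IsEnvelope p n f G := by
  obtain ⟨ℓ, hℓ⟩ := exists_affine_le_penalized hp h
  exact exists_isEnvelope (by linarith) hf (convexOn_affine _ ℓ x) (by fun_prop) hℓ

namespace IsEnvelope

variable {p : ℝ} {n : ℕ} {f : X → EReal} {G : X → ℝ}

theorem toReal_deltaApprox (hG : IsEnvelope p n f G) (x : X) :
    (deltaApprox p n f x).toReal = G x - n * powNorm p x := by
  rw [hG.deltaApprox_eq, EReal.toReal_coe]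

theorem deltaConvex (hG : IsEnvelope p n f G) (hp : 1 ≤ p) : DeltaConvex (deltaApprox p n f) :=
  ⟨G, fun x => n * powNorm p x, hG.convexOn, hG.continuous,
    (convexOn_powNorm hp).smul (c := (n : ℝ)) (by positivity),
    continuous_const.mul (continuous_powNorm (by linarith)), hG.deltaApprox_eq⟩

theorem le_deltaApprox (hG : IsEnvelope p n f G) (hp : 1 ≤ p) {x : X} {a : ℝ}
    (h : ∀ (y z : X) (r : ℝ), f y = r → a ≤ r + n * (cost p z y + cost p x z)) :
    a ≤ G x - n * powNorm p x := by
  obtain ⟨ℓ, hℓ⟩ := exists_affine_le_penalized hp h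
  have := hG.le_of_le_penalized _ (convexOn_affine _ ℓ x) (by fun_prop) hℓ x
  rw [sub_self, map_zero] at this
  linarith

theorem deltaApprox_le (hG : IsEnvelope p n f G) {x : X} {r : ℝ} (hx : f x = r) :
    G x - n * powNorm p x ≤ r := by
  have := hG.le_penalized x x r hx
  rw [penalized, cost_self] at this
  linarith

end IsEnvelope

/-! ### Convex functions with small second differences -/

/-- The symmetric second difference of `G` at `x` with step `h`. -/
def secondDiff (G : X → ℝ) (x h : X) : ℝ := G (x + h) + G (x - h) - 2 * G x

variable {G : X → ℝ}

/-- The subgradient inequality at x - v bounds the remainder at x + v from above by the second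
difference; at x + v it gives nonnegativity. -/
theorem hasFDerivAt_of_secondDiff_le {x : X} {ℓ : X →L[ℝ] ℝ} (hℓ : ∀ z, G x + ℓ (z - x) ≤ G z)
    (h : ∀ ε : ℝ, 0 < ε → ∃ δ : ℝ, 0 < δ ∧ ∀ v : X, ‖v‖ ≤ δ → secondDiff G x v ≤ ε * ‖v‖) :
    HasFDerivAt G ℓ x := by
  rw [hasFDerivAt_iff_isLittleO_nhds_zero, Asymptotics.isLittleO_iff]
  intro ε hε
  obtain ⟨δ, hδ, hd⟩ := h ε hε
  filter_upwards [Metric.closedBall_mem_nhds (0 : X) hδ] with v hv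
  have h1 := hd v (by simpa using hv)
  have h2 := hℓ (x + v)
  have h3 := hℓ (x - v)
  rw [add_sub_cancel_left] at h2
  rw [sub_sub_cancel_left, map_neg] at h3
  rw [secondDiff] at h1
  rw [Real.norm_eq_abs, abs_le]
  constructor <;> linarith [norm_nonneg v]

/-- The subgradients of a function at two points are as close as its second differences at one of
them are small. -/
theorem norm_sub_mul_le_of_secondDiff_le {x y : X} {ℓ m : X →L[ℝ] ℝ} {c : ℝ}
    (hℓ : ∀ z, G x + ℓ (z - x) ≤ G z) (hm : ∀ z, G y + m (z - y) ≤ G z)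
    (h : ∀ v : X, ‖v‖ ≤ 2 * ‖x - y‖ → secondDiff G x v ≤ c) :
    ‖ℓ - m‖ * ‖x - y‖ ≤ c := by
  have hc : 0 ≤ c := by
    have := h 0 (by simp)
    simp only [secondDiff, add_zero, sub_zero] at this
    linarith
  rcases (norm_nonneg (x - y)).eq_or_lt with h0 | h0
  · rw [← h0, mul_zero]; exact hc
  -- Add the inequality for m at y + v to those for ℓ at y and at the reflection of y + v through x;
  -- what remains is the second difference at x with step y + v - x.
  have key : ∀ v : X, ‖v‖ ≤ ‖x - y‖ → (m - ℓ) v ≤ c := by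
    intro v hv
    have h1 := hm (y + v)
    have h2 := hℓ (x - (y + v - x))
    have h3 := hℓ y
    have h4 := h (y + v - x) (by
      rw [show y + v - x = v - (x - y) by abel]
      exact (norm_sub_le _ _).trans (by linarith))
    rw [secondDiff, add_sub_cancel] at h4
    rw [add_sub_cancel_left] at h1
    rw [sub_sub_cancel_left, map_neg, show y + v - x = (y - x) + v by abel, map_add,
      show y - x + v = y + v - x by abel] at h2
    rw [sub_apply]
    linarith
  rw [← le_div_iff₀ h0]
  refine ContinuousLinearMap.opNorm_le_bound _ (by positivity) fun v => ?_
  rcases (norm_nonneg v).eq_or_lt with hv | hv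
  · have : v = 0 := norm_eq_zero.1 hv.symm
    simp [this]
  set t := ‖x - y‖ / ‖v‖ with ht
  have ht0 : 0 < t := by positivity
  have hn : ‖t • v‖ = ‖x - y‖ := by
    rw [norm_smul, Real.norm_of_nonneg ht0.le, ht]; field_simp
  have h1 := key (t • v) hn.le
  have h2 := key (-(t • v)) (by rw [norm_neg, hn])
  rw [map_neg, map_smul, smul_eq_mul, sub_apply] at h2
  rw [map_smul, smul_eq_mul, sub_apply] at h1
  have h3 : t * |(ℓ - m) v| ≤ c := by
    rw [← abs_of_pos ht0, ← abs_mul, abs_le, sub_apply]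
    constructor <;> linarith
  have e : c / ‖x - y‖ * ‖v‖ = c / t := by rw [ht]; field_simp
  rw [Real.norm_eq_abs, e, le_div_iff₀ ht0]
  linarith

theorem differentiable_of_secondDiff_le (hG : ConvexOn ℝ Set.univ G) (hc : Continuous G)
    (h : ∀ x : X, ∀ ε : ℝ, 0 < ε →
      ∃ δ : ℝ, 0 < δ ∧ ∀ v : X, ‖v‖ ≤ δ → secondDiff G x v ≤ ε * ‖v‖) :
    Differentiable ℝ G ∧ ∀ x z, G x + fderiv ℝ G x (z - x) ≤ G z := by
  have key : ∀ x, ∃ ℓ : X →L[ℝ] ℝ, HasFDerivAt G ℓ x ∧ ∀ z, G x + ℓ (z - x) ≤ G z := fun x => by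
    obtain ⟨ℓ, hℓ⟩ := exists_subgradient hG hc x
    exact ⟨ℓ, hasFDerivAt_of_secondDiff_le hℓ (h x), hℓ⟩
  refine ⟨fun x => ?_, fun x => ?_⟩
  · obtain ⟨ℓ, h1, -⟩ := key x
    exact h1.differentiableAt
  · obtain ⟨ℓ, h1, h2⟩ := key x
    rwa [h1.fderiv]

theorem isC1uBdd_of_secondDiff_le (hG : ConvexOn ℝ Set.univ G) (hc : Continuous G)
    (h : ∀ R ε : ℝ, 0 < ε →
      ∃ δ : ℝ, 0 < δ ∧ ∀ x v : X, ‖x‖ ≤ R → ‖v‖ ≤ δ → secondDiff G x v ≤ ε * ‖v‖) :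
    IsC1uBdd G := by
  obtain ⟨hd, hsub⟩ := differentiable_of_secondDiff_le hG hc fun x ε hε => by
    obtain ⟨δ, hδ, hx⟩ := h ‖x‖ ε hε
    exact ⟨δ, hδ, fun v => hx x v le_rfl⟩
  refine ⟨hd, fun B hB => ?_⟩
  obtain ⟨R, hR⟩ := hB.exists_norm_le
  rw [Metric.uniformContinuousOn_iff]
  intro ε hε
  -- Steps have length up to 2 ‖x - y‖, so ε / 4 yields the bound ε / 2 on the derivatives, and δ is
  -- halved below.
  obtain ⟨δ, hδ, hx⟩ := h R (ε / 4) (by positivity)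
  refine ⟨δ / 2, by positivity, fun x hxB y hyB hxy => ?_⟩
  rw [dist_eq_norm] at hxy ⊢
  rcases (norm_nonneg (x - y)).eq_or_lt with h0 | h0
  · have : x = y := sub_eq_zero.1 (norm_eq_zero.1 h0.symm)
    simpa [this] using hε
  have := norm_sub_mul_le_of_secondDiff_le (c := ε / 2 * ‖x - y‖) (hsub x) (hsub y) fun v hv =>
    (hx x v (hR x hxB) (by linarith)).trans (by nlinarith)
  linarith [le_of_mul_le_mul_right this h0]

theorem norm_fderiv_sub_le_rpow {β C : ℝ} (hβ : 0 < β) (hC : 0 ≤ C) {x y : X}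
    (hx : ∀ z, G x + fderiv ℝ G x (z - x) ≤ G z) (hy : ∀ z, G y + fderiv ℝ G y (z - y) ≤ G z)
    (h : ∀ v : X, ‖v‖ ≤ 2 * ‖x - y‖ → secondDiff G x v ≤ C * ‖v‖ ^ (1 + β)) :
    ‖fderiv ℝ G x - fderiv ℝ G y‖ ≤ C * 2 ^ (1 + β) * ‖x - y‖ ^ β := by
  rcases (norm_nonneg (x - y)).eq_or_lt with h0 | h0
  · have : x = y := sub_eq_zero.1 (norm_eq_zero.1 h0.symm)
    simp [this, Real.zero_rpow hβ.ne']
  have h1 := norm_sub_mul_le_of_secondDiff_le (c := C * (2 * ‖x - y‖) ^ (1 + β)) hx hy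
    fun v hv => (h v hv).trans (by gcongr)
  rw [Real.mul_rpow zero_le_two (norm_nonneg _), Real.rpow_one_add' (norm_nonneg (x - y))
    (by positivity)] at h1
  refine le_of_mul_le_mul_right (h1.trans_eq ?_) h0
  ring

theorem exists_secondDiff_le_mul_norm {β C : ℝ} (hβ : 0 < β) (hC : 0 ≤ C) {ε : ℝ} (hε : 0 < ε) :
    ∃ δ : ℝ, 0 < δ ∧ ∀ t : ℝ, 0 ≤ t → t ≤ δ → C * t ^ (1 + β) ≤ ε * t := by
  refine ⟨(ε / (C + 1)) ^ β⁻¹, by positivity, fun t ht htδ => ?_⟩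
  have h1 : t ^ β ≤ ε / (C + 1) := by
    have := Real.rpow_le_rpow ht htδ hβ.le
    rwa [Real.rpow_inv_rpow (by positivity) hβ.ne'] at this
  rw [le_div_iff₀ (by positivity)] at h1
  rw [Real.rpow_one_add' ht (by positivity)]
  have h2 : 0 ≤ t ^ β := by positivity
  nlinarith

theorem isC1HolderBdd_of_secondDiff_le {β : ℝ} (hβ : 0 < β) (hG : ConvexOn ℝ Set.univ G)
    (hc : Continuous G)
    (h : ∀ R : ℝ, 0 < R → ∃ C : ℝ, 0 ≤ C ∧ ∀ x v : X, ‖x‖ ≤ R → ‖v‖ ≤ R →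
      secondDiff G x v ≤ C * ‖v‖ ^ (1 + β)) :
    IsC1HolderBdd β G := by
  obtain ⟨hd, hsub⟩ := differentiable_of_secondDiff_le hG hc fun x ε hε => by
    obtain ⟨C, hC, hx⟩ := h (‖x‖ + 1) (by positivity)
    obtain ⟨δ, hδ, hd⟩ := exists_secondDiff_le_mul_norm hβ hC hε
    refine ⟨min δ (‖x‖ + 1), by positivity, fun v hv => (hx x v (by linarith)
      (hv.trans (min_le_right _ _))).trans (hd _ (norm_nonneg v) (hv.trans (min_le_left _ _)))⟩
  refine ⟨hd, fun B hB => ?_⟩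
  obtain ⟨R, hR0, hR⟩ := hB.exists_pos_norm_le
  -- Steps up to 2 ‖x - y‖ ≤ 4 R occur.
  obtain ⟨C, hC, hx⟩ := h (4 * R) (by positivity)
  refine ⟨C * 2 ^ (1 + β), fun x hxB y hyB => norm_fderiv_sub_le_rpow hβ hC (hsub x) (hsub y)
    fun v hv => hx x v ?_ ?_⟩
  · linarith [hR x hxB]
  · linarith [hR x hxB, hR y hyB, norm_sub_le x y]

theorem isC1Holder_of_secondDiff_le {β C : ℝ} (hβ : 0 < β) (hC : 0 ≤ C)
    (hG : ConvexOn ℝ Set.univ G) (hc : Continuous G)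
    (h : ∀ x v : X, secondDiff G x v ≤ C * ‖v‖ ^ (1 + β)) : IsC1Holder β G := by
  obtain ⟨hd, hsub⟩ := differentiable_of_secondDiff_le hG hc fun x ε hε => by
    obtain ⟨δ, hδ, hd⟩ := exists_secondDiff_le_mul_norm hβ hC hε
    exact ⟨δ, hδ, fun v hv => (h x v).trans (hd _ (norm_nonneg v) hv)⟩
  exact ⟨hd, C * 2 ^ (1 + β), fun x y => norm_fderiv_sub_le_rpow hβ hC (hsub x) (hsub y)
    fun v _ => h x v⟩

theorem IsC1uBdd.sub {F : X → ℝ} (hG : IsC1uBdd G) (hF : IsC1uBdd F) :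
    IsC1uBdd fun x => G x - F x := by
  refine ⟨hG.1.sub hF.1, fun B hB => ?_⟩
  have e : fderiv ℝ (fun x => G x - F x) = fun x => fderiv ℝ G x - fderiv ℝ F x :=
    funext fun x => fderiv_fun_sub (hG.1 x) (hF.1 x)
  rw [e]
  exact uniformContinuousOn_iff_restrict.2
    ((uniformContinuousOn_iff_restrict.1 (hG.2 B hB)).sub
      (uniformContinuousOn_iff_restrict.1 (hF.2 B hB)))

theorem norm_fderiv_sub_sub_le {F : X → ℝ} (hG : Differentiable ℝ G) (hF : Differentiable ℝ F)
    {C D t : ℝ} {x y : X} (h1 : ‖fderiv ℝ G x - fderiv ℝ G y‖ ≤ C * t)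
    (h2 : ‖fderiv ℝ F x - fderiv ℝ F y‖ ≤ D * t) :
    ‖fderiv ℝ (fun x => G x - F x) x - fderiv ℝ (fun x => G x - F x) y‖ ≤ (C + D) * t := by
  rw [fderiv_fun_sub (hG x) (hF x), fderiv_fun_sub (hG y) (hF y), sub_sub_sub_comm]
  exact (norm_sub_le _ _).trans (by linarith)

theorem IsC1HolderBdd.sub {F : X → ℝ} {β : ℝ} (hG : IsC1HolderBdd β G) (hF : IsC1HolderBdd β F) :
    IsC1HolderBdd β fun x => G x - F x := by
  refine ⟨hG.1.sub hF.1, fun B hB => ?_⟩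
  obtain ⟨C, hC⟩ := hG.2 B hB
  obtain ⟨D, hD⟩ := hF.2 B hB
  exact ⟨C + D, fun x hx y hy => norm_fderiv_sub_sub_le hG.1 hF.1 (hC x hx y hy) (hD x hx y hy)⟩

theorem IsC1Holder.sub {F : X → ℝ} {β : ℝ} (hG : IsC1Holder β G) (hF : IsC1Holder β F) :
    IsC1Holder β fun x => G x - F x := by
  obtain ⟨hGd, C, hC⟩ := hG
  obtain ⟨hFd, D, hD⟩ := hF
  exact ⟨hGd.sub hFd, C + D, fun x y => norm_fderiv_sub_sub_le hGd hFd (hC x y) (hD x y)⟩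

/-! ### Second differences of powers of the norm -/

/-- A Lipschitz-type bound at 1, where one constant serves all cases: a ^ s is compared with a when
s ≤ 1, with its tangent (Bernoulli) on [0, 1] or its chord on [1, 2] when s ≥ 1. -/
theorem rpow_sub_one_mul_le {s a : ℝ} (hs : 0 < s) (ha : 0 ≤ a) (ha2 : a ≤ 2) :
    (a ^ s - 1) * (a - 1) ≤ (1 + s + 2 ^ s) * (a - 1) ^ 2 := by
  have h2s : 0 < (2 : ℝ) ^ s := by positivity
  rcases le_total a 1 with h1 | h1
  · have : 1 - a ^ s ≤ (1 + s + 2 ^ s) * (1 - a) := by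
      rcases le_total s 1 with hs1 | hs1
      · have : a ≤ a ^ s := by
          simpa using Real.rpow_le_rpow_of_exponent_ge' ha h1 hs.le hs1
        nlinarith
      · have := one_add_mul_self_le_rpow_one_add (by linarith : -1 ≤ a - 1) hs1
        rw [add_sub_cancel] at this
        nlinarith
    nlinarith
  · have : a ^ s - 1 ≤ (1 + s + 2 ^ s) * (a - 1) := by
      rcases le_total s 1 with hs1 | hs1
      · have : a ^ s ≤ a := by
          simpa using Real.rpow_le_rpow_of_exponent_le h1 hs1
        nlinarith
      · have := (convexOn_rpow hs1).2 (Set.mem_Ici.2 zero_le_one) (Set.mem_Ici.2 zero_le_two)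
          (by linarith : 0 ≤ 2 - a) (by linarith : 0 ≤ a - 1) (by ring)
        simp only [smul_eq_mul, Real.one_rpow] at this
        rw [show (2 - a) * 1 + (a - 1) * 2 = a by ring] at this
        nlinarith
    nlinarith

theorem exists_rpow_le_quadratic {p : ℝ} (hp : 1 < p) :
    ∃ K : ℝ, 0 ≤ K ∧ ∀ a : ℝ, 0 ≤ a → a ≤ 2 → a ^ p ≤ 1 + p * (a - 1) + K * (a - 1) ^ 2 := by
  refine ⟨p * (1 + (p - 1) + 2 ^ (p - 1)), by positivity, fun a ha ha2 => ?_⟩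
  have h1 := rpow_sub_one_mul_le (by linarith : 0 < p - 1) ha ha2
  -- The tangent to the p-th power at a, evaluated at 1; for a > 0 it is Bernoulli's inequality for
  -- the inverse of a.
  have h2 : a ^ p - 1 ≤ p * (a ^ (p - 1) * (a - 1)) := by
    rcases ha.eq_or_lt with rfl | ha0
    · rw [Real.zero_rpow (by linarith), Real.zero_rpow (by linarith)]
      norm_num
    · have h3 := one_add_mul_self_le_rpow_one_add (s := a⁻¹ - 1)
        (by linarith [inv_pos.2 ha0]) hp.le
      rw [add_sub_cancel, Real.inv_rpow ha] at h3
      have h4 : 0 < a ^ p := by positivity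
      have h5 := mul_le_mul_of_nonneg_left h3 h4.le
      rw [mul_inv_cancel₀ h4.ne'] at h5
      have h6 : a ^ p * a⁻¹ = a ^ (p - 1) := by
        rw [Real.rpow_sub_one ha0.ne', div_eq_mul_inv]
      have h7 : a ^ (p - 1) * a = a ^ p := by
        rw [Real.rpow_sub_one ha0.ne']; field_simp
      have h8 : a ^ p * (1 + p * (a⁻¹ - 1)) = a ^ p + p * (a ^ (p - 1) - a ^ p) := by
        rw [← h6]; ring
      rw [h8] at h5
      have h9 : p * (a ^ (p - 1) * (a - 1)) = p * (a ^ p - a ^ (p - 1)) := by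
        rw [← h7]; ring
      rw [h9]
      linarith
  nlinarith

theorem le_smoothnessModulus {u v : X} (hu : ‖u‖ = 1) (hv : v ≠ 0) :
    ‖u + v‖ + ‖u - v‖ - 2 ≤ 2 * smoothnessModulus X ‖v‖ := by
  have hv0 : ‖v‖ ≠ 0 := norm_ne_zero_iff.2 hv
  have hbdd : BddAbove {s : ℝ | ∃ x y : X, ‖x‖ = 1 ∧ ‖y‖ = 1 ∧
      s = (‖x + ‖v‖ • y‖ + ‖x - ‖v‖ • y‖) / 2 - 1} := by
    refine ⟨‖v‖, ?_⟩
    rintro s ⟨x, y, hx, hy, rfl⟩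
    have h1 := norm_add_le x (‖v‖ • y)
    have h2 := norm_sub_le x (‖v‖ • y)
    rw [norm_smul, norm_norm, hx, hy] at h1 h2
    linarith
  have h := le_csSup hbdd ⟨u, ‖v‖⁻¹ • v, hu, by rw [norm_smul, norm_inv, norm_norm]; field_simp, rfl⟩
  rw [smul_inv_smul₀ hv0] at h
  unfold smoothnessModulus
  linarith

theorem secondDiff_powNorm (p : ℝ) (x v : X) :
    secondDiff (powNorm p) x v = 2 ^ (p - 1) * (‖x + v‖ ^ p + ‖x - v‖ ^ p - 2 * ‖x‖ ^ p) := by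
  unfold secondDiff powNorm; ring

theorem secondDiff_powNorm_smul {p t : ℝ} (ht : 0 ≤ t) (x v : X) :
    secondDiff (powNorm p) (t • x) (t • v) = t ^ p * secondDiff (powNorm p) x v := by
  have h : ∀ w : X, ‖t • w‖ ^ p = t ^ p * ‖w‖ ^ p := fun w => by
    rw [norm_smul, Real.norm_of_nonneg ht, Real.mul_rpow ht (norm_nonneg w)]
  rw [secondDiff_powNorm, secondDiff_powNorm, ← smul_add, ← smul_sub, h, h, h]
  ring

/-- By homogeneity take ‖x‖ = 1 and expand the p-th power to second order at 1: the linear terms sum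
to the quantity measured by the modulus of smoothness, the quadratic ones are at most ‖v‖ ^ 2. -/
theorem exists_secondDiff_powNorm_le_modulus {p : ℝ} (hp : 1 < p) :
    ∃ K : ℝ, 0 < K ∧ ∀ x v : X, v ≠ 0 → ‖v‖ ≤ ‖x‖ → secondDiff (powNorm p) x v ≤
      ‖x‖ ^ p * (K * smoothnessModulus X (‖v‖ / ‖x‖) + K * (‖v‖ / ‖x‖) ^ 2) := by
  obtain ⟨K, hK, h⟩ := exists_rpow_le_quadratic hp
  have h2p : 0 < (2 : ℝ) ^ (p - 1) := by positivity
  have hsphere : ∀ u v : X, ‖u‖ = 1 → v ≠ 0 → ‖v‖ ≤ 1 → secondDiff (powNorm p) u v ≤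
      2 ^ (p - 1) * (p * (2 * smoothnessModulus X ‖v‖) + 2 * K * ‖v‖ ^ 2) := by
    intro u v hu hv hv1
    have h1 := norm_add_le u v
    have h2 := norm_sub_le u v
    have h3 := norm_sub_norm_le u (-v)
    have h4 := norm_sub_norm_le u v
    rw [sub_neg_eq_add, norm_neg] at h3
    rw [hu] at h1 h2 h3 h4
    have h5 := h ‖u + v‖ (norm_nonneg _) (by linarith)
    have h6 := h ‖u - v‖ (norm_nonneg _) (by linarith)
    have h7 : (‖u + v‖ - 1) ^ 2 ≤ ‖v‖ ^ 2 := sq_le_sq' (by linarith) (by linarith)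
    have h8 : (‖u - v‖ - 1) ^ 2 ≤ ‖v‖ ^ 2 := sq_le_sq' (by linarith) (by linarith)
    have h9 := le_smoothnessModulus hu hv
    rw [secondDiff_powNorm, hu, Real.one_rpow]
    refine mul_le_mul_of_nonneg_left ?_ h2p.le
    have h10 := mul_le_mul_of_nonneg_left h9 (by linarith : 0 ≤ p)
    have h11 := mul_le_mul_of_nonneg_left h7 hK
    have h12 := mul_le_mul_of_nonneg_left h8 hK
    linarith
  refine ⟨2 ^ (p - 1) * (2 * p + 2 * K), by positivity, fun x v hv hvx => ?_⟩
  have hv0 : 0 < ‖v‖ := norm_pos_iff.2 hv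
  have hx0 : 0 < ‖x‖ := by linarith
  have hn : ‖‖x‖⁻¹ • v‖ = ‖v‖ / ‖x‖ := by
    rw [norm_smul, norm_inv, norm_norm, div_eq_inv_mul]
  have h1 := hsphere (‖x‖⁻¹ • x) (‖x‖⁻¹ • v) (by rw [norm_smul, norm_inv, norm_norm]; field_simp)
    (smul_ne_zero (by positivity) hv) (by rw [hn]; exact (div_le_one hx0).2 hvx)
  have h2 := secondDiff_powNorm_smul (p := p) (norm_nonneg x) (‖x‖⁻¹ • x) (‖x‖⁻¹ • v)
  rw [smul_inv_smul₀ hx0.ne', smul_inv_smul₀ hx0.ne'] at h2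
  rw [h2]
  refine mul_le_mul_of_nonneg_left (h1.trans ?_) (by positivity)
  rw [hn]
  have hρ : 0 ≤ smoothnessModulus X (‖v‖ / ‖x‖) := by
    have h3 := le_smoothnessModulus (u := ‖x‖⁻¹ • x) (v := ‖x‖⁻¹ • v)
      (by rw [norm_smul, norm_inv, norm_norm]; field_simp) (smul_ne_zero (by positivity) hv)
    have h4 := norm_add_le (‖x‖⁻¹ • x + ‖x‖⁻¹ • v) (‖x‖⁻¹ • x - ‖x‖⁻¹ • v)
    rw [show ‖x‖⁻¹ • x + ‖x‖⁻¹ • v + (‖x‖⁻¹ • x - ‖x‖⁻¹ • v) = (2 : ℝ) • (‖x‖⁻¹ • x) by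
      module, norm_smul, norm_smul, norm_inv, norm_norm, inv_mul_cancel₀ hx0.ne'] at h4
    rw [hn] at h3
    norm_num at h4
    linarith
  have hsq : 0 ≤ (‖v‖ / ‖x‖) ^ 2 := by positivity
  have : 0 ≤ 2 ^ (p - 1) * (2 * K * smoothnessModulus X (‖v‖ / ‖x‖)
    + 2 * p * (‖v‖ / ‖x‖) ^ 2) := by positivity
  linarith

theorem secondDiff_powNorm_le_of_le_mul {p c : ℝ} (hp : 0 ≤ p) (hc : 0 ≤ c) {x v : X}
    (h : ‖x‖ ≤ c * ‖v‖) :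
    secondDiff (powNorm p) x v ≤ 2 * (2 ^ (p - 1) * (c + 1) ^ p) * ‖v‖ ^ p := by
  have h2p : 0 < (2 : ℝ) ^ (p - 1) := by positivity
  have h1 : ‖x + v‖ ^ p ≤ ((c + 1) * ‖v‖) ^ p :=
    Real.rpow_le_rpow (norm_nonneg _) ((norm_add_le x v).trans (by linarith)) hp
  have h2 : ‖x - v‖ ^ p ≤ ((c + 1) * ‖v‖) ^ p :=
    Real.rpow_le_rpow (norm_nonneg _) ((norm_sub_le x v).trans (by linarith)) hp
  rw [Real.mul_rpow (by positivity) (norm_nonneg v)] at h1 h2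
  have h3 : 0 ≤ ‖x‖ ^ p := by positivity
  rw [secondDiff_powNorm]
  calc _ ≤ 2 ^ (p - 1) * (2 * ((c + 1) ^ p * ‖v‖ ^ p)) :=
        mul_le_mul_of_nonneg_left (by linarith) h2p.le
    _ = _ := by ring

theorem norm_rpow_le_powNorm {p : ℝ} (hp : 1 ≤ p) (x : X) : ‖x‖ ^ p ≤ powNorm p x :=
  le_mul_of_one_le_left (by positivity) (Real.one_le_rpow one_le_two (by linarith))

theorem rpow_le_one_add_powNorm {p q : ℝ} (hp : 1 ≤ p) (hq : 0 ≤ q) (hqp : q ≤ p) (x : X) :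
    ‖x‖ ^ q ≤ 1 + powNorm p x := by
  refine le_trans ?_ (add_le_add_right (norm_rpow_le_powNorm hp x) 1)
  have hxp : 0 ≤ ‖x‖ ^ p := by positivity
  rcases le_total ‖x‖ 1 with h | h
  · linarith [Real.rpow_le_one (norm_nonneg x) h hq]
  · linarith [Real.rpow_le_rpow_of_exponent_le h hqp]

theorem secondDiff_zero_right (G : X → ℝ) (x : X) : secondDiff G x 0 = 0 := by
  simp only [secondDiff, add_zero, sub_zero]; ring

/-- If ‖v‖ is small relative to ‖x‖, uniform smoothness applies; otherwise everything is of order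
‖v‖ ^ p = o(‖v‖). The weight absorbs ‖x‖ ^ (p - 1) and is the form the envelope estimate accepts. -/
theorem exists_secondDiff_powNorm_le_mul_norm (hUS : UniformlySmooth X) {p : ℝ} (hp : 1 < p)
    {ε : ℝ} (hε : 0 < ε) :
    ∃ δ : ℝ, 0 < δ ∧ ∀ x v : X, ‖v‖ ≤ δ →
      secondDiff (powNorm p) x v ≤ ε * ‖v‖ * (1 + powNorm p x) := by
  obtain ⟨K, hK, h⟩ := exists_secondDiff_powNorm_le_modulus (X := X) hp
  have hev : ∀ᶠ τ in 𝓝[>] (0 : ℝ),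
      K * (smoothnessModulus X τ / τ) + K * τ < ε := by
    have h1 : Tendsto (fun τ : ℝ => K * (smoothnessModulus X τ / τ) + K * τ) (𝓝[>] 0)
        (𝓝 (K * 0 + K * 0)) :=
      (hUS.const_mul K).add ((tendsto_id.mono_left nhdsWithin_le_nhds).const_mul K)
    exact h1.eventually_lt_const (by simpa using hε)
  obtain ⟨τ₁, hτ₁, hsub⟩ := mem_nhdsGT_iff_exists_Ioc_subset.1 hev
  set τ₀ := min τ₁ 1
  have hτ₀ : 0 < τ₀ := lt_min hτ₁ one_pos
  set C := 2 * (2 ^ (p - 1) * (τ₀⁻¹ + 1) ^ p)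
  have hC : 0 ≤ C := by positivity
  obtain ⟨δ, hδ, hd⟩ := exists_secondDiff_le_mul_norm (by linarith : 0 < p - 1) hC hε
  refine ⟨δ, hδ, fun x v hv => ?_⟩
  rcases eq_or_ne v 0 with rfl | hv0
  · rw [secondDiff_zero_right]; simp
  have hvpos : 0 < ‖v‖ := norm_pos_iff.2 hv0
  have hφ := powNorm_nonneg p x
  rcases le_total ‖v‖ (τ₀ * ‖x‖) with h1 | h1
  · have hx0 : 0 < ‖x‖ := by
      by_contra! h0
      nlinarith
    have h2 : ‖v‖ / ‖x‖ ≤ τ₀ := (div_le_iff₀ hx0).2 h1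
    have h3 : 0 < ‖v‖ / ‖x‖ := by positivity
    have h4 : K * (smoothnessModulus X (‖v‖ / ‖x‖) / (‖v‖ / ‖x‖)) + K * (‖v‖ / ‖x‖) < ε :=
      hsub ⟨h3, h2.trans (min_le_left _ _)⟩
    have h5 : K * smoothnessModulus X (‖v‖ / ‖x‖) + K * (‖v‖ / ‖x‖) ^ 2 ≤ ε * (‖v‖ / ‖x‖) := by
      refine le_trans (le_of_eq ?_) (mul_le_mul_of_nonneg_right h4.le h3.le)
      field_simp
    have h6 : ‖v‖ ≤ ‖x‖ := h1.trans (mul_le_of_le_one_left hx0.le (min_le_right _ _))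
    refine (h x v hv0 h6).trans ((mul_le_mul_of_nonneg_left h5 (by positivity)).trans ?_)
    have h7 := rpow_le_one_add_powNorm hp.le (by linarith : 0 ≤ p - 1) (by linarith) x
    calc ‖x‖ ^ p * (ε * (‖v‖ / ‖x‖)) = ε * ‖v‖ * ‖x‖ ^ (p - 1) := by
          rw [Real.rpow_sub_one hx0.ne']; ring
      _ ≤ _ := by gcongr
  · have h2 : ‖x‖ ≤ τ₀⁻¹ * ‖v‖ := by rwa [← div_eq_inv_mul, le_div_iff₀' hτ₀]
    refine (secondDiff_powNorm_le_of_le_mul (by linarith) (by positivity) h2).trans ?_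
    have h3 := hd ‖v‖ hvpos.le hv
    rw [add_sub_cancel] at h3
    refine h3.trans (le_mul_of_one_le_right (by positivity) (by linarith))

theorem exists_secondDiff_powNorm_le_of_powerType {p q : ℝ} (hp : 1 < p) (hq2 : q ≤ 2)
    (hS : SmoothnessPowerType X q) :
    ∃ C : ℝ, 0 < C ∧ ∀ x v : X, v ≠ 0 →
      (‖v‖ ≤ ‖x‖ → secondDiff (powNorm p) x v ≤ C * (‖x‖ ^ p * (‖v‖ / ‖x‖) ^ q)) ∧
      (‖x‖ ≤ ‖v‖ → secondDiff (powNorm p) x v ≤ C * ‖v‖ ^ p) := by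
  obtain ⟨K, hK, h⟩ := exists_secondDiff_powNorm_le_modulus (X := X) hp
  obtain ⟨D, hD, hS⟩ := hS
  set C₂ := 2 * ((2 : ℝ) ^ (p - 1) * (1 + 1) ^ p)
  have hC₂ : 0 < C₂ := by positivity
  refine ⟨max (K * (D + 1)) C₂, by positivity, fun x v hv => ⟨fun hvx => ?_, fun hxv => ?_⟩⟩
  · have hv0 : 0 < ‖v‖ := norm_pos_iff.2 hv
    have hx0 : 0 < ‖x‖ := by linarith
    have hτ : 0 < ‖v‖ / ‖x‖ := by positivity
    have h1 := hS _ hτ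
    have h2 : (‖v‖ / ‖x‖) ^ 2 ≤ (‖v‖ / ‖x‖) ^ q := by
      have := Real.rpow_le_rpow_of_exponent_ge hτ ((div_le_one hx0).2 hvx) hq2
      exact_mod_cast this
    refine (h x v hv hvx).trans ?_
    calc _ ≤ ‖x‖ ^ p * (K * (D * (‖v‖ / ‖x‖) ^ q) + K * (‖v‖ / ‖x‖) ^ q) := by gcongr
      _ = K * (D + 1) * (‖x‖ ^ p * (‖v‖ / ‖x‖) ^ q) := by ring
      _ ≤ _ := by gcongr; exact le_max_left _ _
  · refine (secondDiff_powNorm_le_of_le_mul (by linarith) zero_le_one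
      (by linarith : ‖x‖ ≤ 1 * ‖v‖)).trans ?_
    gcongr
    exact le_max_right _ _

theorem exists_secondDiff_powNorm_le_rpow {p q q' : ℝ} (hp : 1 < p) (hq2 : q ≤ 2)
    (hS : SmoothnessPowerType X q) (hq0 : 0 < q') (hqq : q' ≤ q) (hqp : q' ≤ p) (R : ℝ) :
    ∃ C : ℝ, 0 < C ∧ ∀ x v : X, ‖v‖ ≤ R →
      secondDiff (powNorm p) x v ≤ C * ‖v‖ ^ q' * (1 + powNorm p x) := by
  obtain ⟨C, hC, h⟩ := exists_secondDiff_powNorm_le_of_powerType (X := X) hp hq2 hS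
  refine ⟨C * max 1 (R ^ (p - q')), mul_pos hC (lt_max_of_lt_left one_pos), fun x v hvR => ?_⟩
  have hφ := powNorm_nonneg p x
  rcases eq_or_ne v 0 with rfl | hv
  · rw [secondDiff_zero_right]; positivity
  have hv0 : 0 < ‖v‖ := norm_pos_iff.2 hv
  rcases le_total ‖v‖ ‖x‖ with h1 | h1
  · have hx0 : 0 < ‖x‖ := by linarith
    have h2 : (‖v‖ / ‖x‖) ^ q ≤ (‖v‖ / ‖x‖) ^ q' :=
      Real.rpow_le_rpow_of_exponent_ge (by positivity) ((div_le_one hx0).2 h1) hqq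
    have h3 := rpow_le_one_add_powNorm hp.le (by linarith : 0 ≤ p - q') (by linarith) x
    calc _ ≤ C * (‖x‖ ^ p * (‖v‖ / ‖x‖) ^ q) := (h x v hv).1 h1
      _ ≤ C * (‖x‖ ^ p * (‖v‖ / ‖x‖) ^ q') := by gcongr
      _ = C * 1 * ‖v‖ ^ q' * ‖x‖ ^ (p - q') := by
        rw [Real.div_rpow hv0.le hx0.le, Real.rpow_sub hx0]; ring
      _ ≤ _ := by
        gcongr
        exact le_max_left _ _
  · calc _ ≤ C * ‖v‖ ^ p := (h x v hv).2 h1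
      _ = C * ‖v‖ ^ (p - q') * ‖v‖ ^ q' * 1 := by
        rw [mul_one, mul_assoc, ← Real.rpow_add hv0]; congr 2; ring
      _ ≤ _ := by
        gcongr
        · exact (Real.rpow_le_rpow hv0.le hvR (by linarith)).trans (le_max_right _ _)
        · linarith

/-- When the power type equals p the powers of ‖x‖ cancel, so no weight is needed; this gives the
global Hölder class. -/
theorem exists_secondDiff_powNorm_le_rpow_self {p : ℝ} (hp : 1 < p) (hp2 : p ≤ 2)
    (hS : SmoothnessPowerType X p) :
    ∃ C : ℝ, 0 < C ∧ ∀ x v : X, secondDiff (powNorm p) x v ≤ C * ‖v‖ ^ p := by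
  obtain ⟨C, hC, h⟩ := exists_secondDiff_powNorm_le_of_powerType (X := X) hp hp2 hS
  refine ⟨C, hC, fun x v => ?_⟩
  rcases eq_or_ne v 0 with rfl | hv
  · rw [secondDiff_zero_right]; positivity
  have hv0 : 0 < ‖v‖ := norm_pos_iff.2 hv
  rcases le_total ‖v‖ ‖x‖ with h1 | h1
  · have hx0 : 0 < ‖x‖ := by linarith
    refine ((h x v hv).1 h1).trans (le_of_eq ?_)
    rw [Real.div_rpow hv0.le hx0.le]
    field_simp
  · exact (h x v hv).2 h1

/-! ### Regularity of the envelope -/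

theorem secondDiff_nonneg {G : X → ℝ} (hG : ConvexOn ℝ Set.univ G) (x v : X) :
    0 ≤ secondDiff G x v := by
  have h := hG.2 (Set.mem_univ (x + v)) (Set.mem_univ (x - v)) (by norm_num : (0 : ℝ) ≤ 1 / 2)
    (by norm_num : (0 : ℝ) ≤ 1 / 2) (by norm_num)
  rw [show (1 / 2 : ℝ) • (x + v) + (1 / 2 : ℝ) • (x - v) = x by module] at h
  simp only [smul_eq_mul] at h
  rw [secondDiff]
  linarith

theorem penalized_eq (p : ℝ) (n : ℕ) (r : ℝ) (x y : X) :
    penalized p n r x y = r + 2 * (n * powNorm p x) + n * powNorm p y - n * ‖x + y‖ ^ p := by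
  unfold penalized cost; ring

/-- φ(x) occurs twice, and the concave term -n ‖x + y‖ ^ p only helps; hence the bound does not
depend on y. -/
theorem secondDiff_penalized_le {p : ℝ} (hp : 1 ≤ p) (n : ℕ) (r : ℝ) (x y v : X) :
    secondDiff (fun x => penalized p n r x y) x v ≤ 2 * n * secondDiff (powNorm p) x v := by
  have h := secondDiff_nonneg (convexOn_powNorm (X := X) hp) (x + y) v
  rw [secondDiff_powNorm] at h
  have h2 := nonneg_of_mul_nonneg_right h (by positivity)
  have h3 := mul_nonneg (Nat.cast_nonneg (α := ℝ) n) h2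
  simp only [secondDiff, penalized_eq]
  rw [show x + v + y = x + y + v by abel, show x - v + y = x + y - v by abel]
  linarith

/-- On bounded sets the second differences of `H` are controlled by those of `powNorm p`. -/
def SecondDiffControlled (p : ℝ) (H : X → ℝ) : Prop :=
  ∀ R : ℝ, ∃ M : ℝ, 0 < M ∧ ∀ (b : ℝ) (v : X), 0 ≤ b →
    (∀ x, secondDiff (powNorm p) x v ≤ b * (1 + powNorm p x)) →
    ∀ x : X, ‖x‖ ≤ R → secondDiff H x v ≤ M * b

theorem powNorm_le_of_norm_le {p R : ℝ} (hp : 0 ≤ p) {x : X} (hx : ‖x‖ ≤ R) :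
    powNorm p x ≤ 2 ^ (p - 1) * R ^ p := by
  unfold powNorm; gcongr

theorem secondDiffControlled_mul_powNorm {p : ℝ} (hp : 0 ≤ p) (n : ℕ) :
    SecondDiffControlled p fun x : X => n * powNorm p x := by
  intro R
  refine ⟨n * (1 + |2 ^ (p - 1) * R ^ p|) + 1, by positivity, fun b v hb h x hx => ?_⟩
  have h1 := h x
  have h2 := (powNorm_le_of_norm_le hp hx).trans (le_abs_self _)
  have h3 : secondDiff (fun x : X => n * powNorm p x) x v = n * secondDiff (powNorm p) x v := by
    unfold secondDiff; ring
  rw [h3]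
  calc _ ≤ n * (b * (1 + powNorm p x)) := by gcongr
    _ ≤ n * (b * (1 + |2 ^ (p - 1) * R ^ p|)) := by gcongr
    _ ≤ _ := by linarith

section Regularity

variable {p : ℝ} {H : X → ℝ}

theorem SecondDiffControlled.isC1uBdd (hH : SecondDiffControlled p H) (hUS : UniformlySmooth X)
    (hp : 1 < p) (hconv : ConvexOn ℝ Set.univ H) (hcont : Continuous H) : IsC1uBdd H := by
  refine isC1uBdd_of_secondDiff_le hconv hcont fun R ε hε => ?_
  obtain ⟨M, hM, h⟩ := hH R
  obtain ⟨δ, hδ, hd⟩ := exists_secondDiff_powNorm_le_mul_norm hUS hp (div_pos hε hM)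
  refine ⟨δ, hδ, fun x v hx hv => (h (ε / M * ‖v‖) v (by positivity)
    (fun z => hd z v hv) x hx).trans (le_of_eq ?_)⟩
  field_simp

theorem SecondDiffControlled.isC1HolderBdd (hH : SecondDiffControlled p H) (hp : 1 < p)
    {α : ℝ} (hα : 0 < α) (hα1 : α ≤ 1) (hS : SmoothnessPowerType X (1 + α))
    (hconv : ConvexOn ℝ Set.univ H) (hcont : Continuous H) :
    IsC1HolderBdd (min α (p - 1)) H := by
  have hβ : 0 < min α (p - 1) := lt_min hα (by linarith)
  refine isC1HolderBdd_of_secondDiff_le hβ hconv hcont fun R hR => ?_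
  obtain ⟨M, hM, h⟩ := hH R
  obtain ⟨C, hC, hd⟩ := exists_secondDiff_powNorm_le_rpow (X := X) (q' := 1 + min α (p - 1)) hp
    (by linarith) hS (by linarith) (by linarith [min_le_left α (p - 1)])
    (by linarith [min_le_right α (p - 1)]) R
  exact ⟨M * C, by positivity, fun x v hx hv => (h (C * ‖v‖ ^ (1 + min α (p - 1))) v
    (by positivity) (fun z => hd z v hv) x hx).trans (mul_assoc _ _ _).ge⟩

end Regularity

namespace IsEnvelope

variable {p : ℝ} {n : ℕ} {f : X → EReal} {G : X → ℝ}

/-- Second differences of the envelope are bounded by those of `powNorm p`, because a suitable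
rescaling of the average of two translates of the envelope is again a convex minorant. -/
theorem secondDiff_le (hG : IsEnvelope p n f G) (hp : 1 ≤ p) {m : ℝ}
    (hm : ∀ (y : X) (r : ℝ), f y = r → m ≤ r) {a b : ℝ} {v : X} (hb : 0 ≤ b)
    (h : ∀ x, secondDiff (powNorm p) x v ≤ a + b * powNorm p x) (x : X) :
    secondDiff G x v ≤ 2 * (n * a + b * (G x - m)) := by
  have hb1 : 0 < 1 + b := by linarith
  -- The half-sum of `penalized` at x ± v exceeds its value P at x by at most n a + b n φ(x) ≤ n a +
  -- b (P - m). Solving for P dictates the factor 1 / (1 + b) and the shift b m - n a.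
  have hconv : ConvexOn ℝ Set.univ fun x =>
      (1 + b)⁻¹ * ((1 / 2) * (G (x + v) + G (x - v)) + (b * m - n * a)) := by
    have h1 : ConvexOn ℝ Set.univ fun x => G (x + v) := by
      simpa [Function.comp_def] using hG.convexOn.translate_left v
    have h2 : ConvexOn ℝ Set.univ fun x => G (x - v) := by
      simpa [Function.comp_def, ← sub_eq_add_neg] using hG.convexOn.translate_left (-v)
    exact (((h1.add h2).smul (by norm_num : (0 : ℝ) ≤ 1 / 2)).add_const _).smul
      (by positivity : 0 ≤ (1 + b)⁻¹)
  have hcont : Continuous fun x =>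
      (1 + b)⁻¹ * ((1 / 2) * (G (x + v) + G (x - v)) + (b * m - n * a)) := by
    have := hG.continuous
    fun_prop
  have hle := hG.le_of_le_penalized _ hconv hcont (fun x y r hy => ?_) x
  · rw [inv_mul_le_iff₀ hb1] at hle
    rw [secondDiff]
    linarith
  · rw [inv_mul_le_iff₀ hb1]
    have h1 := hG.le_penalized (x + v) y r hy
    have h2 := hG.le_penalized (x - v) y r hy
    have h3 := secondDiff_penalized_le hp n r x y v
    have h4 := mul_le_mul_of_nonneg_left (h x) (Nat.cast_nonneg (α := ℝ) n)
    have h5 : n * powNorm p x ≤ penalized p n r x y - m := by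
      have := mul_nonneg (Nat.cast_nonneg (α := ℝ) n) (cost_nonneg hp x y)
      rw [penalized]
      linarith [hm y r hy]
    have h6 := mul_le_mul_of_nonneg_left h5 hb
    simp only [secondDiff] at h3 h4
    linarith

theorem exists_le_of_norm_le (hG : IsEnvelope p n f G) (hp : 0 ≤ p) {y₀ : X} {r₀ : ℝ}
    (hy₀ : f y₀ = r₀) (R : ℝ) : ∃ M : ℝ, ∀ x, ‖x‖ ≤ R → G x ≤ M := by
  refine ⟨r₀ + 2 * (n * (2 ^ (p - 1) * R ^ p)) + n * powNorm p y₀, fun x hx => ?_⟩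
  have h1 := hG.le_penalized x y₀ r₀ hy₀
  have h2 := mul_le_mul_of_nonneg_left (powNorm_le_of_norm_le hp hx) (Nat.cast_nonneg (α := ℝ) n)
  have h3 : 0 ≤ n * ‖x + y₀‖ ^ p := by positivity
  rw [penalized_eq] at h1
  linarith

theorem secondDiffControlled (hG : IsEnvelope p n f G) (hp : 1 ≤ p) {m : ℝ}
    (hm : ∀ (y : X) (r : ℝ), f y = r → m ≤ r) {y₀ : X} {r₀ : ℝ} (hy₀ : f y₀ = r₀) :
    SecondDiffControlled p G := by
  intro R
  obtain ⟨M, hM⟩ := hG.exists_le_of_norm_le (by linarith) hy₀ R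
  refine ⟨2 * (n + |M - m|) + 1, by positivity, fun b v hb h x hx => ?_⟩
  refine (hG.secondDiff_le hp hm hb (fun z => (h z).trans_eq (mul_one_add b _)) x).trans ?_
  have h1 := mul_le_mul_of_nonneg_left
    ((sub_le_sub_right (hM x hx) m).trans (le_abs_self _)) hb
  linarith

theorem isC1Holder (hG : IsEnvelope p n f G) (hp : 1 < p) {m : ℝ}
    (hm : ∀ (y : X) (r : ℝ), f y = r → m ≤ r) {α : ℝ} (hα : 0 < α) (hα1 : α ≤ 1)
    (hS : SmoothnessPowerType X (1 + α)) (hpα : p = 1 + α) :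
    IsC1Holder α fun x => G x - n * powNorm p x := by
  obtain ⟨C, hC, h⟩ := exists_secondDiff_powNorm_le_rpow_self hp (by linarith) (hpα ▸ hS)
  refine (isC1Holder_of_secondDiff_le (C := 2 * (n * C)) hα (by positivity) hG.convexOn
    hG.continuous fun x v => ?_).sub (isC1Holder_of_secondDiff_le (C := n * C) hα (by positivity)
    ((convexOn_powNorm hp.le).smul (Nat.cast_nonneg n))
    (continuous_const.mul (continuous_powNorm (by linarith))) fun x v => ?_)
  -- With b = 0 the estimate is independent of x, hence global.
  · have := hG.secondDiff_le (a := C * ‖v‖ ^ p) hp.le hm le_rfl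
      (fun z => (h z v).trans (by linarith)) x
    rw [← hpα]
    linarith
  · have h1 := mul_le_mul_of_nonneg_left (h x v) (Nat.cast_nonneg (α := ℝ) n)
    rw [← hpα]
    simp only [secondDiff] at h1 ⊢
    linarith

end IsEnvelope

/-! ### Convergence -/

/-- Points y near x are covered by `hlow`; for the others the two-step cost is at least δ, and n δ ≥
M - m closes the gap between A and the lower bound m of f. -/
theorem eventually_forall_le_add_cost {p : ℝ} (hp : 1 ≤ p) {K : Set X} (hK : CostControlled p K)
    {f : X → EReal} {m M ε : ℝ} {A : X → ℝ} (hε : 0 < ε) (hA : ∀ x ∈ K, A x ≤ M)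
    (hm : ∀ (y : X) (r : ℝ), f y = r → m ≤ r)
    (hlow : ∀ x ∈ K, ∀ (y : X) (r : ℝ), ‖y - x‖ < ε → f y = r → A x ≤ r) :
    ∃ N : ℕ, ∀ n ≥ N, ∀ x ∈ K, ∀ (y z : X) (r : ℝ), f y = r →
      A x ≤ r + n * (cost p z y + cost p x z) := by
  obtain ⟨δ, hδ, h⟩ := hK ε hε
  obtain ⟨N, hN⟩ := exists_nat_ge ((M - m) / δ)
  refine ⟨N, fun n hn x hx y z r hy => ?_⟩
  have h1 := cost_nonneg hp z y
  have h2 := cost_nonneg hp x z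
  have hn0 : (0 : ℝ) ≤ n := Nat.cast_nonneg n
  rcases lt_or_ge ‖y - x‖ ε with hyx | hyx
  · have := hlow x hx y r hyx hy
    have := mul_nonneg hn0 (add_nonneg h1 h2)
    linarith
  · have h3 : δ ≤ cost p z y + cost p x z := by
      by_contra! hlt
      exact absurd (h x hx z y (by linarith) (by linarith)) (not_lt.2 hyx)
    have h4 : M - m ≤ n * δ := by
      rw [div_le_iff₀ hδ] at hN
      have : (N : ℝ) ≤ n := by exact_mod_cast hn
      nlinarith
    have h5 := mul_le_mul_of_nonneg_left h3 hn0
    linarith [hA x hx, hm y r hy]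

theorem tendstoUniformlyOn_of_costControlled {p : ℝ} (hp : 1 ≤ p) {K : Set X}
    (hK : CostControlled p K) {f : X → EReal} {F : X → ℝ} (hfF : ∀ x, f x = F x) {m M : ℝ}
    (hm : ∀ (y : X) (r : ℝ), f y = r → m ≤ r) (hM : ∀ x ∈ K, F x ≤ M)
    (hF : ∀ η : ℝ, 0 < η → ∃ ε : ℝ, 0 < ε ∧ ∀ x ∈ K, ∀ y, ‖y - x‖ < ε → F x - η ≤ F y)
    {G : ℕ → X → ℝ} (hG : ∀ n, IsEnvelope p n f (G n)) :
    TendstoUniformlyOn (fun (n : ℕ) x => (deltaApprox p n f x).toReal) F atTop K := by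
  rw [Metric.tendstoUniformlyOn_iff]
  intro η hη
  obtain ⟨ε, hε, h⟩ := hF (η / 2) (half_pos hη)
  obtain ⟨N, hN⟩ := eventually_forall_le_add_cost (A := fun x => F x - η / 2) (M := M) (f := f)
    hp hK hε (fun x hx => by linarith [hM x hx]) hm fun x hx y r hyx hy => by
      rw [hfF, EReal.coe_eq_coe_iff] at hy
      exact hy ▸ h x hx y hyx
  filter_upwards [eventually_ge_atTop N] with n hn x hx
  rw [(hG n).toReal_deltaApprox, Real.dist_eq, abs_lt]
  have h1 := (hG n).le_deltaApprox hp (hN n hn x hx)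
  have h2 := (hG n).deltaApprox_le (hfF x)
  constructor <;> linarith

theorem tendsto_deltaApprox (hLUC : LocallyUniformlyConvex X) {p : ℝ} (hp : 1 < p) {f : X → EReal}
    (hf : LowerSemicontinuous f) {m : ℝ} (hm : ∀ (y : X) (r : ℝ), f y = r → m ≤ r)
    {G : ℕ → X → ℝ} (hG : ∀ n, IsEnvelope p n f (G n)) {x : X}
    (hle : ∀ n : ℕ, deltaApprox p n f x ≤ f x) :
    Tendsto (fun n : ℕ => deltaApprox p n f x) atTop (𝓝 (f x)) := by
  refine tendsto_order.2 ⟨fun a ha => ?_, fun a ha => Eventually.of_forall fun n =>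
    (hle n).trans_lt ha⟩
  obtain ⟨s, has, hsf⟩ := EReal.lt_iff_exists_real_btwn.1 ha
  obtain ⟨ε, hε, h⟩ := Metric.eventually_nhds_iff.1 (hf x s hsf)
  obtain ⟨N, hN⟩ := eventually_forall_le_add_cost (A := fun _ => s) (M := s) (f := f) hp.le
    (costControlled_of_isCompact hLUC hp (isCompact_singleton (x := x))) hε
    (fun _ _ => le_rfl) hm fun z hz y r hyz hy => by
      rw [Set.mem_singleton_iff] at hz
      subst hz
      have : (s : EReal) < f y := h (by rwa [dist_eq_norm] : dist y z < ε)
      rw [hy, EReal.coe_lt_coe_iff] at this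
      exact this.le
  filter_upwards [eventually_ge_atTop N] with n hn
  refine has.trans_le ?_
  rw [(hG n).deltaApprox_eq, EReal.coe_le_coe_iff]
  exact (hG n).le_deltaApprox hp.le (hN n hn x rfl)

/-- A value of `f` above its infimum is detected by every approximating function. -/
theorem exists_lt_forall_le_add_cost (hLUC : LocallyUniformlyConvex X) {p : ℝ} (hp : 1 < p)
    {f : X → EReal} (hf : LowerSemicontinuous f) {m : ℝ}
    (hm : ∀ (y : X) (r : ℝ), f y = r → m ≤ r) {x : X} (hx : m < f x) {n : ℕ} (hn : 1 ≤ n) :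
    ∃ a : ℝ, m < a ∧ ∀ (y z : X) (r : ℝ), f y = r → a ≤ r + n * (cost p z y + cost p x z) := by
  obtain ⟨s, hms, hsf⟩ := EReal.lt_iff_exists_real_btwn.1 hx
  rw [EReal.coe_lt_coe_iff] at hms
  obtain ⟨ε, hε, h⟩ := Metric.eventually_nhds_iff.1 (hf x s hsf)
  obtain ⟨δ, hδ, hc⟩ := costControlled_of_isCompact hLUC hp (isCompact_singleton (x := x)) ε hε
  -- Values of f near x exceed s; away from x the cost adds at least δ to m, already for n = 1.
  refine ⟨min s (m + δ), lt_min hms (by linarith), fun y z r hy => ?_⟩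
  have h1 := cost_nonneg hp.le z y
  have h2 := cost_nonneg hp.le x z
  have hn1 : (1 : ℝ) ≤ n := by exact_mod_cast hn
  have h3 : cost p z y + cost p x z ≤ n * (cost p z y + cost p x z) :=
    le_mul_of_one_le_left (by linarith) hn1
  rcases lt_or_ge ‖y - x‖ ε with hyx | hyx
  · have : (s : EReal) < f y := h (by rwa [dist_eq_norm] : dist y x < ε)
    rw [hy, EReal.coe_lt_coe_iff] at this
    linarith [min_le_left s (m + δ)]
  · have h4 : δ ≤ cost p z y + cost p x z := by
      by_contra! hlt
      exact absurd (hc x rfl z y (by linarith) (by linarith)) (not_lt.2 hyx)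
    linarith [min_le_right s (m + δ), hm y r hy]

/-! ### Growth of uniformly continuous functions and uniform convergence -/

theorem abs_sub_le_nat_mul_of_convex {S : Set X} (hS : Convex ℝ S) {F : X → ℝ} {δ η : ℝ}
    (h : ∀ x ∈ S, ∀ y ∈ S, ‖x - y‖ ≤ δ → |F x - F y| ≤ η) (N : ℕ) :
    ∀ x ∈ S, ∀ y ∈ S, ‖x - y‖ ≤ N * δ → |F x - F y| ≤ N * η := by
  induction N with
  | zero =>
    intro x _ y _ hxy
    have h0 : ‖x - y‖ = 0 := le_antisymm (by simpa using hxy) (norm_nonneg _)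
    have : x = y := sub_eq_zero.1 (norm_eq_zero.1 h0)
    simp [this]
  | succ N ih =>
    intro x hx y hy hxy
    push_cast at hxy ⊢
    have hN : (0 : ℝ) < N + 1 := by positivity
    set t : ℝ := ((N : ℝ) + 1)⁻¹ with ht
    have ht0 : 0 ≤ t := by positivity
    have ht1 : t ≤ 1 := inv_le_one_of_one_le₀ (by linarith [Nat.cast_nonneg (α := ℝ) N])
    have htN : (1 - t) * (N + 1) = N := by rw [ht]; field_simp; ring
    have hw : (1 - t) • x + t • y ∈ S := hS hx hy (by linarith) ht0 (by ring)
    have e1 : x - ((1 - t) • x + t • y) = t • (x - y) := by module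
    have e2 : (1 - t) • x + t • y - y = (1 - t) • (x - y) := by module
    have h1 : ‖x - ((1 - t) • x + t • y)‖ ≤ δ := by
      rw [e1, norm_smul, Real.norm_of_nonneg ht0, ht, inv_mul_le_iff₀ hN]
      exact hxy
    have h2 : ‖(1 - t) • x + t • y - y‖ ≤ N * δ := by
      rw [e2, norm_smul, Real.norm_of_nonneg (by linarith : 0 ≤ 1 - t)]
      calc _ ≤ (1 - t) * ((N + 1) * δ) := mul_le_mul_of_nonneg_left hxy (by linarith)
        _ = N * δ := by rw [← mul_assoc, htN]
    have h3 := h x hx _ hw h1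
    have h4 := ih _ hw y hy h2
    have h5 := abs_sub_le (F x) (F ((1 - t) • x + t • y)) (F y)
    linarith

/-- Split the segment into pieces no longer than δ: uniform continuity on a convex set implies a
Lipschitz bound up to an additive constant. -/
theorem abs_sub_le_mul_add_of_convex {S : Set X} (hS : Convex ℝ S) {F : X → ℝ} {δ η : ℝ}
    (hδ : 0 < δ) (hη : 0 ≤ η) (h : ∀ x ∈ S, ∀ y ∈ S, ‖x - y‖ ≤ δ → |F x - F y| ≤ η)
    {x y : X} (hx : x ∈ S) (hy : y ∈ S) : |F x - F y| ≤ η / δ * ‖x - y‖ + η := by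
  have h1 : ‖x - y‖ ≤ ⌈‖x - y‖ / δ⌉₊ * δ := by
    rw [← div_le_iff₀ hδ]; exact Nat.le_ceil _
  refine (abs_sub_le_nat_mul_of_convex hS h _ x hx y hy h1).trans ?_
  have h2 : (⌈‖x - y‖ / δ⌉₊ : ℝ) ≤ ‖x - y‖ / δ + 1 := (Nat.ceil_lt_add_one (by positivity)).le
  calc _ ≤ (‖x - y‖ / δ + 1) * η := by gcongr
    _ = _ := by ring

theorem UniformContinuousOnBounded.exists_forall_le {F : X → ℝ} (hF : UniformContinuousOnBounded F)
    {B : Set X} (hB : Bornology.IsBounded B) :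
    (∃ M : ℝ, ∀ x ∈ B, F x ≤ M) ∧
    ∀ η : ℝ, 0 < η → ∃ ε : ℝ, 0 < ε ∧ ∀ x ∈ B, ∀ y, ‖y - x‖ < ε → F x - η ≤ F y := by
  obtain ⟨R, hR0, hR⟩ := hB.exists_pos_norm_le
  -- The radius is enlarged by 1 because y need not lie in B.
  have hU := Metric.uniformContinuousOn_iff.1
    (hF (Metric.closedBall 0 (R + 1)) Metric.isBounded_closedBall)
  have hmem : ∀ x ∈ B, x ∈ Metric.closedBall (0 : X) (R + 1) := fun x hx => by
    rw [mem_closedBall_zero_iff]; linarith [hR x hx]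
  constructor
  · obtain ⟨δ, hδ, h⟩ := hU 1 one_pos
    refine ⟨F 0 + (1 / (δ / 2) * R + 1), fun x hx => ?_⟩
    have h1 := abs_sub_le_mul_add_of_convex (convex_closedBall (0 : X) (R + 1)) (half_pos hδ)
      zero_le_one (fun x hx y hy hxy => (h x hx y hy (by rw [dist_eq_norm]; linarith)).le)
      (hmem x hx) (Metric.mem_closedBall_self (by positivity))
    have h2 : 1 / (δ / 2) * ‖x - 0‖ ≤ 1 / (δ / 2) * R := by
      rw [sub_zero]
      exact mul_le_mul_of_nonneg_left (hR x hx) (by positivity)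
    linarith [(abs_le.1 h1).2]
  · intro η hη
    obtain ⟨δ, hδ, h⟩ := hU η hη
    refine ⟨min δ 1, by positivity, fun x hx y hyx => ?_⟩
    have hy : y ∈ Metric.closedBall (0 : X) (R + 1) := by
      rw [mem_closedBall_zero_iff]
      have h1 := norm_add_le (y - x) x
      rw [sub_add_cancel] at h1
      linarith [hR x hx, hyx.trans_le (min_le_right _ _)]
    have h2 := h y hy x (hmem x hx) (by rw [dist_eq_norm]; exact hyx.trans_le (min_le_left _ _))
    rw [Real.dist_eq] at h2
    linarith [(abs_lt.1 h2).1]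

theorem exists_forall_mul_le_add_rpow {κ p : ℝ} (hκ : 0 < κ) (hp : 2 ≤ p) (L : ℝ) :
    ∃ a : ℝ, ∀ t : ℝ, 0 ≤ t → L * t ≤ a + κ * t ^ p := by
  set T := max 1 (|L| / κ)
  have hT : 0 < T := lt_max_of_lt_left one_pos
  refine ⟨|L| * T, fun t ht => ?_⟩
  have hL : L * t ≤ |L| * t := mul_le_mul_of_nonneg_right (le_abs_self L) ht
  have htp : 0 ≤ κ * t ^ p := by positivity
  rcases le_total t T with h | h
  · have := mul_le_mul_of_nonneg_left h (abs_nonneg L)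
    linarith
  · have h1 : 1 ≤ t := (le_max_left _ _).trans h
    have h2 : t ^ 2 ≤ t ^ p := by
      have := Real.rpow_le_rpow_of_exponent_le h1 hp
      exact_mod_cast this
    have h3 : |L| / κ ≤ t := (le_max_right _ _).trans h
    rw [div_le_iff₀ hκ] at h3
    have h4 : 0 ≤ |L| * T := by positivity
    nlinarith

theorem exists_mul_norm_sub_rpow_le_cost_add {p : ℝ} (hp : 2 ≤ p) (hC : ConvexityPowerType X p) :
    ∃ C : ℝ, 0 < C ∧ ∀ x y z : X, C * ‖x - y‖ ^ p ≤ cost p z y + cost p x z := by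
  obtain ⟨C, hC0, h⟩ := exists_mul_norm_sub_rpow_le_cost hp hC
  have h2p : (0 : ℝ) < 2 ^ (p - 1) := by positivity
  refine ⟨C * (2 ^ (p - 1))⁻¹, by positivity, fun x y z => ?_⟩
  have h1 : ‖x - y‖ ^ p ≤ 2 ^ (p - 1) * (‖x - z‖ ^ p + ‖z - y‖ ^ p) := by
    have h3 : ‖x - y‖ ≤ ‖x - z‖ + ‖z - y‖ := norm_sub_le_norm_sub_add_norm_sub x z y
    have h4 := scalarCost_nonneg (by linarith : 1 ≤ p) (norm_nonneg (x - z)) (norm_nonneg (z - y))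
    rw [scalarCost] at h4
    linarith [Real.rpow_le_rpow (norm_nonneg _) h3 (by linarith : 0 ≤ p)]
  rw [← inv_mul_le_iff₀ h2p] at h1
  have h5 := mul_le_mul_of_nonneg_left h1 hC0.le
  linarith [h x z, h z y]

section UniformlyContinuous

variable {p : ℝ} {F : X → ℝ}

/-- F falls at most linearly away from 0, and the p-th power growth of the cost compensates this as
soon as n ≥ 1; no lower bound on F is needed. -/
theorem exists_isEnvelope_of_uniformContinuous (hp : 2 ≤ p) (hC : ConvexityPowerType X p)
    (hF : UniformContinuous F) {n : ℕ} (hn : 1 ≤ n) :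
    ∃ G, IsEnvelope p n (fun x => (F x : EReal)) G := by
  obtain ⟨C, hC0, hc⟩ := exists_mul_norm_sub_rpow_le_cost_add hp hC
  obtain ⟨δ, hδ, h⟩ := Metric.uniformContinuous_iff.1 hF 1 one_pos
  obtain ⟨a, ha⟩ := exists_forall_mul_le_add_rpow hC0 hp (1 / (δ / 2))
  refine exists_isEnvelope_of_le (by linarith)
    ⟨fun x => EReal.coe_ne_bot _, 0, EReal.coe_ne_top _⟩ (x := 0) (a := F 0 - a - 1)
    fun y z r hy => ?_
  rw [EReal.coe_eq_coe_iff] at hy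
  have h1 := abs_sub_le_mul_add_of_convex (convex_univ (𝕜 := ℝ) (E := X)) (half_pos hδ)
    zero_le_one (fun x _ y _ hxy => (h (by rw [dist_eq_norm]; linarith : dist x y < δ)).le)
    (Set.mem_univ 0) (Set.mem_univ y)
  have h2 := ha ‖0 - y‖ (norm_nonneg _)
  have h3 := hc 0 y z
  have h4 : cost p z y + cost p 0 z ≤ n * (cost p z y + cost p 0 z) :=
    le_mul_of_one_le_left (add_nonneg (cost_nonneg (by linarith) _ _)
      (cost_nonneg (by linarith) _ _)) (by exact_mod_cast hn)
  linarith [(abs_le.1 h1).2]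

theorem tendstoUniformly_of_uniformContinuous (hp : 2 ≤ p) (hC : ConvexityPowerType X p)
    (hF : UniformContinuous F) :
    TendstoUniformly (fun (n : ℕ) x => (deltaApprox p n (fun x => (F x : EReal)) x).toReal)
      F atTop := by
  rw [Metric.tendstoUniformly_iff]
  intro ε hε
  obtain ⟨C, hC0, hc⟩ := exists_mul_norm_sub_rpow_le_cost_add hp hC
  obtain ⟨δ', hδ', h⟩ := Metric.uniformContinuous_iff.1 hF (ε / 4) (by positivity)
  set δ := δ' / 2 with hδdef
  have hδ : 0 < δ := half_pos hδ'
  -- Chosen so that the slope ε / (4 δ) is at most N C δ ^ (p - 1): the cost then beats the linear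
  -- growth at distances t ≥ δ, while for t ≤ δ that growth is at most ε / 4.
  obtain ⟨N, hN⟩ := exists_nat_ge (ε / 4 / δ / (C * δ ^ (p - 1)))
  filter_upwards [eventually_ge_atTop N, eventually_ge_atTop 1] with n hnN hn1 x
  obtain ⟨G, hG⟩ := exists_isEnvelope_of_uniformContinuous hp hC hF hn1
  rw [hG.toReal_deltaApprox, Real.dist_eq, abs_lt]
  have h2 := hG.deltaApprox_le (x := x) rfl
  have h1 : F x - ε / 2 ≤ G x - n * powNorm p x := by
    refine hG.le_deltaApprox (by linarith) fun y z r hy => ?_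
    rw [EReal.coe_eq_coe_iff] at hy
    have h3 := abs_sub_le_mul_add_of_convex (convex_univ (𝕜 := ℝ) (E := X)) hδ
      (by positivity : 0 ≤ ε / 4)
      (fun x _ y _ hxy => (h (by rw [dist_eq_norm]; linarith : dist x y < δ')).le)
      (Set.mem_univ x) (Set.mem_univ y)
    set t := ‖x - y‖
    have ht : 0 ≤ t := norm_nonneg _
    have hnc := mul_le_mul_of_nonneg_left (hc x y z) (Nat.cast_nonneg (α := ℝ) n)
    have hlin : ε / 4 / δ * t ≤ ε / 4 + n * (C * t ^ p) := by
      rcases le_total t δ with htδ | htδ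
      · have h4 : ε / 4 / δ * t ≤ ε / 4 / δ * δ := by gcongr
        rw [div_mul_cancel₀ _ hδ.ne'] at h4
        have : 0 ≤ n * (C * t ^ p) := by positivity
        linarith
      · have ht0 : 0 < t := by linarith
        rw [div_le_iff₀ (by positivity)] at hN
        calc ε / 4 / δ * t ≤ N * (C * δ ^ (p - 1)) * t := by gcongr
          _ ≤ n * (C * t ^ (p - 1)) * t := by
            have : δ ^ (p - 1) ≤ t ^ (p - 1) :=
              Real.rpow_le_rpow hδ.le htδ (by linarith)
            gcongr
          _ = n * (C * t ^ p) := by rw [Real.rpow_sub_one ht0.ne']; field_simp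
          _ ≤ _ := by linarith
    linarith [(abs_le.1 h3).2]
  constructor <;> linarith

end UniformlyContinuous

end DeltaApprox

/-! ### Assembly of the five assertions -/

theorem theorem1 {X : Type*} [NormedAddCommGroup X] [NormedSpace ℝ X] [CompleteSpace X]
    (hLUC : DeltaApprox.LocallyUniformlyConvex X) (hUS : DeltaApprox.UniformlySmooth X)
    (p : ℝ) (hp : 1 < p) :
    (∀ f : X → EReal, DeltaApprox.Proper f → LowerSemicontinuous f → DeltaApprox.BddBelowFun f →
      -- the approximating functions are real-valued and Δ-convex
      (∀ n : ℕ, 1 ≤ n → DeltaApprox.DeltaConvex (DeltaApprox.deltaApprox p n f)) ∧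
      -- (i)
      (∀ n : ℕ, 1 ≤ n →
        (∀ x, (⨅ z, f z) ≤ DeltaApprox.deltaApprox p n f x ∧
          DeltaApprox.deltaApprox p n f x ≤ f x) ∧
        (⨅ x, DeltaApprox.deltaApprox p n f x) = (⨅ x, f x) ∧
        DeltaApprox.argInf (DeltaApprox.deltaApprox p n f) = DeltaApprox.argInf f) ∧
      -- (ii)
      (∀ n : ℕ, 1 ≤ n →
        DeltaApprox.IsC1uBdd (fun x => (DeltaApprox.deltaApprox p n f x).toReal)) ∧
      (∀ α : ℝ, 0 < α → α ≤ 1 → DeltaApprox.SmoothnessPowerType X (1 + α) →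
        ∀ n : ℕ, 1 ≤ n →
          DeltaApprox.IsC1HolderBdd (min α (p - 1))
            (fun x => (DeltaApprox.deltaApprox p n f x).toReal) ∧
          (p = 1 + α →
            DeltaApprox.IsC1Holder α (fun x => (DeltaApprox.deltaApprox p n f x).toReal))) ∧
      -- (iii)
      (∀ x, Tendsto (fun n : ℕ => DeltaApprox.deltaApprox p n f x) atTop (𝓝 (f x))) ∧
      (∀ F : X → ℝ, (∀ x, f x = (F x : EReal)) → Continuous F →
        ∀ K : Set X, IsCompact K →
          TendstoUniformlyOn (fun (n : ℕ) x => (DeltaApprox.deltaApprox p n f x).toReal)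
            F atTop K) ∧
      -- (iv)
      (UniformConvexSpace X →
        ∀ F : X → ℝ, (∀ x, f x = (F x : EReal)) → DeltaApprox.UniformContinuousOnBounded F →
          ∀ B : Set X, Bornology.IsBounded B →
            TendstoUniformlyOn (fun (n : ℕ) x => (DeltaApprox.deltaApprox p n f x).toReal)
              F atTop B)) ∧
    -- (v)
    (UniformConvexSpace X → 2 ≤ p → DeltaApprox.ConvexityPowerType X p →
      ∀ F : X → ℝ, UniformContinuous F →
        (∀ n : ℕ, 1 ≤ n →
          DeltaApprox.DeltaConvex (DeltaApprox.deltaApprox p n (fun x => (F x : EReal)))) ∧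
        TendstoUniformly
          (fun (n : ℕ) x => (DeltaApprox.deltaApprox p n (fun x => (F x : EReal)) x).toReal)
          F atTop) := by
  open DeltaApprox in
  refine ⟨fun f hf hlsc hbdd => ?_, fun _ hp2 hC F hF => ?_⟩
  · obtain ⟨m₀, hm₀⟩ := hbdd
    obtain ⟨y₀, hy₀⟩ := hf.2
    have hr₀ := (EReal.coe_toReal hy₀ (hf.1 y₀)).symm
    set r₀ := (f y₀).toReal
    have hI_bot : (⨅ z, f z) ≠ ⊥ := fun h => by
      have := (le_iInf hm₀).trans_eq h
      exact EReal.coe_ne_bot m₀ (le_bot_iff.1 this)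
    have hI_top : (⨅ z, f z) ≠ ⊤ := fun h => by
      have := h.ge.trans ((iInf_le f y₀).trans_eq hr₀)
      exact EReal.coe_ne_top r₀ (top_le_iff.1 this)
    have hI := (EReal.coe_toReal hI_top hI_bot).symm
    set m := (⨅ z, f z).toReal
    have hm : ∀ (y : X) (r : ℝ), f y = r → m ≤ r := fun y r hy => by
      have := iInf_le f y
      rwa [hI, hy, EReal.coe_le_coe_iff] at this
    have hmin : ∀ (n : ℕ) (x y z : X) (r : ℝ), f y = r →
        m ≤ r + n * (cost p z y + cost p x z) := fun n x y z r hy => by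
      have := mul_nonneg (Nat.cast_nonneg (α := ℝ) n)
        (add_nonneg (cost_nonneg hp.le z y) (cost_nonneg hp.le x z))
      linarith [hm y r hy]
    -- The constant m = inf f serves as lower bound at the base point 0, so an envelope exists for
    -- every n, including n = 0.
    choose G hG using fun n : ℕ => exists_isEnvelope_of_le (n := n) hp.le hf (hmin n 0)
    have hle : ∀ (n : ℕ) (x : X), deltaApprox p n f x ≤ f x := fun n x => by
      rcases eq_or_ne (f x) ⊤ with hx | hx
      · rw [hx]; exact le_top
      · have hr := (EReal.coe_toReal hx (hf.1 x)).symm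
        rw [hr, (hG n).deltaApprox_eq, EReal.coe_le_coe_iff]
        exact (hG n).deltaApprox_le hr
    have hge : ∀ (n : ℕ) (x : X), (⨅ z, f z) ≤ deltaApprox p n f x := fun n x => by
      rw [hI, (hG n).deltaApprox_eq, EReal.coe_le_coe_iff]
      exact (hG n).le_deltaApprox hp.le (hmin n x)
    have hinf : ∀ n : ℕ, (⨅ x, deltaApprox p n f x) = ⨅ x, f x := fun n =>
      le_antisymm (iInf_mono (hle n)) (le_iInf (hge n))
    have hreal : ∀ n : ℕ, (fun x => (deltaApprox p n f x).toReal)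
        = fun x => G n x - n * powNorm p x := fun n => funext (hG n).toReal_deltaApprox
    have hφ_conv : ∀ n : ℕ, ConvexOn ℝ Set.univ fun x : X => n * powNorm p x := fun n =>
      (convexOn_powNorm hp.le).smul (Nat.cast_nonneg n)
    have hφ_cont : ∀ n : ℕ, Continuous fun x : X => n * powNorm p x := fun n =>
      continuous_const.mul (continuous_powNorm (by linarith))
    have hG_sd : ∀ n, SecondDiffControlled p (G n) := fun n =>
      (hG n).secondDiffControlled hp.le hm hr₀
    have hφ_sd : ∀ n : ℕ, SecondDiffControlled p fun x : X => n * powNorm p x := fun n =>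
      secondDiffControlled_mul_powNorm (by linarith) n
    refine ⟨fun n _ => (hG n).deltaConvex hp.le,
      fun n hn => ⟨fun x => ⟨hge n x, hle n x⟩, hinf n, ?_⟩, fun n _ => ?_,
      fun α hα hα1 hS n _ => ⟨?_, fun hpα => ?_⟩,
      fun x => tendsto_deltaApprox hLUC hp hlsc hm hG fun n => hle n x,
      fun F hfF hF K hK => ?_, fun _ F hfF hF B hB => ?_⟩
    · ext x
      simp only [argInf, Set.mem_ofPred_eq, hinf n]
      refine ⟨fun hx => ?_, fun hx => le_antisymm ((hle n x).trans_eq hx) (hge n x)⟩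
      by_contra hne
      have hlt : (m : EReal) < f x := by
        rw [← hI]; exact lt_of_le_of_ne (iInf_le f x) (Ne.symm hne)
      obtain ⟨a, hma, ha⟩ := exists_lt_forall_le_add_cost hLUC hp hlsc hm hlt hn
      have h1 := (hG n).le_deltaApprox hp.le ha
      rw [(hG n).deltaApprox_eq, hI, EReal.coe_eq_coe_iff] at hx
      linarith
    · rw [hreal]
      exact ((hG_sd n).isC1uBdd hUS hp (hG n).convexOn (hG n).continuous).sub
        ((hφ_sd n).isC1uBdd hUS hp (hφ_conv n) (hφ_cont n))
    · rw [hreal]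
      exact ((hG_sd n).isC1HolderBdd hp hα hα1 hS (hG n).convexOn (hG n).continuous).sub
        ((hφ_sd n).isC1HolderBdd hp hα hα1 hS (hφ_conv n) (hφ_cont n))
    · rw [hreal]
      exact (hG n).isC1Holder hp hm hα hα1 hS hpα
    · obtain ⟨M, hM⟩ := (hK.image hF).bddAbove
      refine tendstoUniformlyOn_of_costControlled hp.le (costControlled_of_isCompact hLUC hp hK)
        hfF hm (fun x hx => hM (Set.mem_image_of_mem F hx)) (fun η hη => ?_) hG
      -- Compactness gives uniformity for x in K against all y in the space, not just y in K.
      obtain ⟨ε, hε, h⟩ := Metric.mem_uniformity_dist.1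
        (hK.uniformContinuousAt_of_continuousAt F (fun x _ => hF.continuousAt)
          (Metric.dist_mem_uniformity hη))
      refine ⟨ε, hε, fun x hx y hyx => ?_⟩
      have h1 : dist (F x) (F y) < η := h (by rwa [dist_comm, dist_eq_norm] : dist x y < ε) hx
      rw [Real.dist_eq] at h1
      linarith [(abs_lt.1 h1).2]
    · obtain ⟨⟨M, hM⟩, hlow⟩ := hF.exists_forall_le hB
      exact tendstoUniformlyOn_of_costControlled hp.le (costControlled_of_isBounded hp hB)
        hfF hm hM hlow hG
  · refine ⟨fun n hn => ?_, tendstoUniformly_of_uniformContinuous hp2 hC hF⟩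
    obtain ⟨G, hG⟩ := exists_isEnvelope_of_uniformContinuous hp2 hC hF hn
    exact hG.deltaConvex hp.le
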